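/- Let $k$ be a field, $Q$ a finite quiver with path algebra $kQ$ (the product $\beta\alpha$ means "first $\alpha$, then $\beta$"), $J$ the two-sided ideal of $kQ$ generated by the arrows, and $\Lambda=kQ/J^2$. Let $Q^{\mathrm{op}}$ be the opposite quiver, with reversed arrows $\alpha^*$. Modules are left modules, not necessarily finitely generated. A differential projective $\Lambda$-module is a pair $(M,d)$ where $M$ is a projective $\Lambda$-module and $d$ is an endomorphism of $M$ with $d^2=0$; morphisms $(M,d)\to(N,\delta)$ are the $\Lambda$-module maps $f$ with $fd=\delta f$. A $\Lambda$-module map $f\colon M\to N$ is null homotopic if $f=rd+\delta r$ for some $\Lambda$-module map $r\colon M\to N$. $(M,d)$ is contractible if $1_M$ is null homotopic, and reduced if it has no nonzero contractible direct summand. The homotopy category of differential projective $\Lambda$-modules has the differential projective modules as objects and the morphisms modulo null homotopic ones as morphisms. For $(M,d)$ reduced, $d(M)\subseteq \operatorname{rad} M$, and for each $x\in M$ one can write $d(x)=\sum_{\alpha}\alpha y_\alpha$, the sum running over the arrows $\alpha$ of $Q$, with $y_\alpha\in e_{s(\alpha)}M$, where the classes of the $y_\alpha$ in $M/\operatorname{rad}M$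 depend only on the class of $x$. Let $F(M,d)$ be the $kQ^{\mathrm{op}}$-module with underlying space $M/\operatorname{rad} M$, on which the trivial paths $e_i$ act as in $\Lambda$ and $\alpha^*$ acts by $\alpha^*\cdot[x]=[y_\alpha]$. Taking induced maps on tops, $F$ is a functor from reduced differential projective $\Lambda$-modules to $kQ^{\mathrm{op}}$-modules. Then every object of the homotopy category is isomorphic there to a reduced differential projective $\Lambda$-module, and there is a bijection $\Phi$ from the isomorphism classes of objects of the homotopy category of differential projective $\Lambda$-modules to the isomorphism classes of $kQ^{\mathrm{op}}$-modules such that $\Phi([M])=[F(M)]$ for every reduced differential projective $\Lambda$-module $M$. Moreover, an object of the homotopy category is indecomposable if and only if the corresponding $kQ^{\mathrm{op}}$-module is indecomposable. -/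

import Mathlib

open CategoryTheory CategoryTheory.Limits

set_option linter.unusedSectionVars false

universe u v w t

noncomputable section

namespace DifferentialProjective

/-! ## The path algebra of a finite quiver -/

/-- The path algebra `kQ` of a quiver `Q` with vertex set `V`: the vector space with basis the
paths of `Q`. -/
def PathAlgebra (k : Type u) [Field k] (V : Type v) [Quiver.{w} V] : Type (max u v w) :=
  (Σ i j : V, Quiver.Path i j) →₀ k

namespace PathAlgebra

variable {k : Type u} [Field k] {V : Type v} [Quiver.{w} V]

instance : AddCommGroup (PathAlgebra k V) :=
  inferInstanceAs (AddCommGroup ((Σ i j : V, Quiver.Path i j) →₀ k))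

instance : Module k (PathAlgebra k V) :=
  inferInstanceAs (Module k ((Σ i j : V, Quiver.Path i j) →₀ k))

/-- The basis element given by a path. -/
def path {i j : V} (p : Quiver.Path i j) : PathAlgebra k V := Finsupp.single ⟨i, j, p⟩ 1

/-- The linear map with prescribed values on the basis of paths. -/
def linearLift {E : Type*} [AddCommGroup E] [Module k E]
    (f : ∀ i j : V, Quiver.Path i j → E) : PathAlgebra k V →ₗ[k] E :=
  Finsupp.linearCombination k (fun x : Σ i j : V, Quiver.Path i j => f x.1 x.2.1 x.2.2)

@[simp] lemma linearLift_path {E : Type*} [AddCommGroup E] [Module k E]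
    (f : ∀ i j : V, Quiver.Path i j → E) {i j : V} (p : Quiver.Path i j) :
    linearLift (k := k) f (path p) = f i j p := by
  exact (Finsupp.linearCombination_single k 1 _).trans (one_smul k _)

lemma linear_ext {E : Type*} [AddCommGroup E] [Module k E] {f g : PathAlgebra k V →ₗ[k] E}
    (h : ∀ (i j : V) (p : Quiver.Path i j), f (path p) = g (path p)) : f = g := by
  refine Finsupp.lhom_ext' fun x => LinearMap.ext_ring ?_
  exact h x.1 x.2.1 x.2.2

open Classical in
/-- The product `q p` of two paths: the path "first `p`, then `q`" if `q` starts where `p` ends,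
and zero otherwise. -/
def pathMul {i j i' j' : V} (q : Quiver.Path i' j') (p : Quiver.Path i j) : PathAlgebra k V :=
  if h : j = i' then path (p.comp (h ▸ q)) else 0

/-- The bilinear extension of the product of paths. -/
def mulLin : PathAlgebra k V →ₗ[k] PathAlgebra k V →ₗ[k] PathAlgebra k V :=
  linearLift fun _ _ q => linearLift fun _ _ p => pathMul q p

instance : Mul (PathAlgebra k V) := ⟨fun x y => mulLin x y⟩

/-- The unit is the sum of the trivial paths. -/
instance : One (PathAlgebra k V) := ⟨∑ᶠ i : V, path (Quiver.Path.nil : Quiver.Path i i)⟩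

lemma mul_def (x y : PathAlgebra k V) : x * y = mulLin x y := rfl

lemma one_def : (1 : PathAlgebra k V) = ∑ᶠ i : V, path (Quiver.Path.nil : Quiver.Path i i) := rfl

lemma path_mul_path {i j l : V} (q : Quiver.Path j l) (p : Quiver.Path i j) :
    (path q * path p : PathAlgebra k V) = path (p.comp q) := by
  simp [mul_def, mulLin, pathMul]

lemma path_mul_path_of_ne {i j i' j' : V} (q : Quiver.Path i' j') (p : Quiver.Path i j)
    (h : j ≠ i') : (path q * path p : PathAlgebra k V) = 0 := by
  simp [mul_def, mulLin, pathMul, h]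

lemma one_mulLin [Finite V] (x : PathAlgebra k V) : mulLin 1 x = x := by
  classical
  let _ := Fintype.ofFinite V
  suffices h : mulLin (1 : PathAlgebra k V) = LinearMap.id from by rw [h]; rfl
  refine linear_ext fun i j p => ?_
  rw [one_def, finsum_eq_sum_of_fintype, map_sum, LinearMap.sum_apply, Finset.sum_eq_single j]
  · exact path_mul_path (k := k) Quiver.Path.nil p
  · intro l _ hl
    exact path_mul_path_of_ne (k := k) Quiver.Path.nil p hl.symm
  · simp

lemma mulLin_one [Finite V] (x : PathAlgebra k V) : mulLin x 1 = x := by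
  classical
  let _ := Fintype.ofFinite V
  suffices h : mulLin.flip (1 : PathAlgebra k V) = LinearMap.id from LinearMap.congr_fun h x
  refine linear_ext fun i j p => ?_
  rw [one_def, finsum_eq_sum_of_fintype, map_sum, LinearMap.sum_apply, Finset.sum_eq_single i]
  · refine (path_mul_path (k := k) p Quiver.Path.nil).trans ?_
    rw [Quiver.Path.nil_comp]; rfl
  · intro l _ hl
    exact path_mul_path_of_ne (k := k) p Quiver.Path.nil hl
  · simp

lemma path_mul_assoc {i j i' j' i'' j'' : V} (r : Quiver.Path i'' j'') (q : Quiver.Path i' j')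
    (p : Quiver.Path i j) :
    (path r * path q * path p : PathAlgebra k V) = path r * (path q * path p) := by
  by_cases h₁ : j = i'
  · subst h₁
    by_cases h₂ : j' = i''
    · subst h₂
      simp [path_mul_path]
    · rw [path_mul_path_of_ne r q h₂, path_mul_path, path_mul_path_of_ne _ _ h₂]
      simp [mul_def]
  · rw [path_mul_path_of_ne q p h₁]
    by_cases h₂ : j' = i''
    · subst h₂
      rw [path_mul_path, path_mul_path_of_ne _ _ h₁]
      simp [mul_def]
    · rw [path_mul_path_of_ne r q h₂]
      simp [mul_def]

lemma mulLin_assoc (x y z : PathAlgebra k V) :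
    mulLin (mulLin x y) z = mulLin x (mulLin y z) := by
  suffices h : (mulLin (k := k) (V := V)).compr₂ mulLin =
      (LinearMap.llcomp k _ _ _).compl₁₂ mulLin mulLin from
    LinearMap.congr_fun (LinearMap.congr_fun (LinearMap.congr_fun h x) y) z
  refine linear_ext fun _ _ r => linear_ext fun _ _ q => linear_ext fun _ _ p => ?_
  exact path_mul_assoc r q p

instance [Finite V] : Ring (PathAlgebra k V) where
  __ := (inferInstance : AddCommGroup (PathAlgebra k V))
  mul_assoc := mulLin_assoc
  one_mul := one_mulLin
  mul_one := mulLin_one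
  left_distrib x y z := map_add (mulLin x) y z
  right_distrib x y z := by simp [mul_def]
  zero_mul x := by simp [mul_def]
  mul_zero x := by simp [mul_def]

instance [Finite V] : Algebra k (PathAlgebra k V) :=
  Algebra.ofModule (fun r x y => by simp [mul_def]) (fun r x y => by simp [mul_def])

/-! ### The universal property of the path algebra -/

section Lift

variable {A : Type*} [Ring A] [Algebra k A]

/-- The value of a path for given values of the trivial paths and of the arrows. -/
def pathVal (e : V → A) (a : ∀ ⦃i j : V⦄, (i ⟶ j) → A) {i : V} :
    ∀ {j : V}, Quiver.Path i j → A
  | _, .nil => e i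
  | _, .cons p f => a f * pathVal e a p

variable (e : V → A) (a : ∀ ⦃i j : V⦄, (i ⟶ j) → A)

lemma vertex_mul_pathVal (hee : ∀ i, e i * e i = e i)
    (hea : ∀ ⦃i j : V⦄ (f : i ⟶ j), e j * a f = a f) {i j : V} (p : Quiver.Path i j) :
    e j * pathVal e a p = pathVal e a p := by
  cases p with
  | nil => exact hee _
  | cons p f => rw [pathVal, ← mul_assoc, hea]

lemma pathVal_mul_vertex (hee : ∀ i, e i * e i = e i) {i j : V} (p : Quiver.Path i j) :
    pathVal e a p * e i = pathVal e a p := by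
  induction p with
  | nil => exact hee _
  | cons p f ih => rw [pathVal, mul_assoc, ih]

lemma pathVal_comp (hee : ∀ i, e i * e i = e i)
    (hea : ∀ ⦃i j : V⦄ (f : i ⟶ j), e j * a f = a f)
    {i j l : V} (p : Quiver.Path i j) (q : Quiver.Path j l) :
    pathVal e a (p.comp q) = pathVal e a q * pathVal e a p := by
  induction q with
  | nil => exact (vertex_mul_pathVal e a hee hea p).symm
  | cons q f ih => rw [Quiver.Path.comp_cons, pathVal, pathVal, ih, mul_assoc]

/-- The algebra homomorphism out of the path algebra with prescribed values on the trivial paths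
and on the arrows. -/
def lift [Finite V] (hee : ∀ i, e i * e i = e i) (hne : ∀ i j, i ≠ j → e i * e j = 0)
    (hone : ∑ᶠ i, e i = 1) (hea : ∀ ⦃i j : V⦄ (f : i ⟶ j), e j * a f = a f) :
    PathAlgebra k V →ₐ[k] A :=
  AlgHom.ofLinearMap (linearLift fun _ _ p => pathVal e a p)
    (by
      let _ := Fintype.ofFinite V
      rw [one_def, finsum_eq_sum_of_fintype, map_sum, ← hone, finsum_eq_sum_of_fintype]
      simp [pathVal])
    (by
      intro x y
      suffices h : (mulLin (k := k) (V := V)).compr₂ (linearLift fun _ _ p => pathVal e a p) =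
          (LinearMap.mul k A).compl₁₂ (linearLift fun _ _ p => pathVal e a p)
            (linearLift fun _ _ p => pathVal e a p) from
        LinearMap.congr_fun (LinearMap.congr_fun h x) y
      refine linear_ext fun i' j' q => linear_ext fun i j p => ?_
      simp only [LinearMap.compr₂_apply, LinearMap.compl₁₂_apply, linearLift_path,
        LinearMap.mul_apply', ← mul_def]
      by_cases h : j = i'
      · subst h
        rw [path_mul_path, linearLift_path, pathVal_comp e a hee hea]
      · rw [path_mul_path_of_ne q p h, map_zero, ← vertex_mul_pathVal e a hee hea p,
          ← pathVal_mul_vertex e a hee q, mul_assoc, ← mul_assoc (e i'), hne _ _ (Ne.symm h),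
          zero_mul, mul_zero])

end Lift

/-- The idempotent given by the trivial path at a vertex. -/
def vertex (k : Type u) [Field k] {V : Type v} [Quiver.{w} V] (i : V) : PathAlgebra k V :=
  path (Quiver.Path.nil : Quiver.Path i i)

/-- The element given by an arrow. -/
def arrow (k : Type u) [Field k] {V : Type v} [Quiver.{w} V] {i j : V} (f : i ⟶ j) :
    PathAlgebra k V :=
  path f.toPath

lemma path_cons {i j l : V} (p : Quiver.Path i j) (f : j ⟶ l) :
    (path (p.cons f) : PathAlgebra k V) = arrow k f * path p :=
  (path_mul_path f.toPath p).symm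

variable [Finite V]

variable (k V) in
/-- The arrow ideal of the path algebra: the two-sided ideal generated by the arrows. -/
def arrowIdeal : Ideal (PathAlgebra k V) :=
  (TwoSidedIdeal.span {x | ∃ (i j : V) (f : i ⟶ j), x = arrow k f}).asIdeal

instance : (arrowIdeal k V).IsTwoSided :=
  inferInstanceAs (TwoSidedIdeal.asIdeal _).IsTwoSided

/-- The augmentation at a vertex `i`: the coefficient of the trivial path at `i`. -/
def aug (i : V) : PathAlgebra k V →ₐ[k] k := by
  classical
  exact lift (fun j => if j = i then 1 else 0) (fun _ _ _ => 0) (by simp)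
    (by intro j l h; by_cases hj : j = i <;> by_cases hl : l = i <;> simp_all)
    (by rw [finsum_eq_single _ i (by intro j hj; simp [hj])]; simp)
    (by simp)

lemma lift_path {A : Type*} [Ring A] [Algebra k A] (e : V → A)
    (a : ∀ ⦃i j : V⦄, (i ⟶ j) → A) (h₁ h₂ h₃ h₄) {i j : V} (p : Quiver.Path i j) :
    lift (k := k) e a h₁ h₂ h₃ h₄ (path p) = pathVal e a p :=
  linearLift_path _ p

lemma aug_vertex_self (i : V) : aug i (vertex k i) = 1 := by
  simp [aug, vertex, lift_path, pathVal]

lemma aug_vertex_of_ne {i j : V} (h : j ≠ i) : aug i (vertex k j) = 0 := by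
  simp [aug, vertex, lift_path, pathVal, h]

lemma aug_cons (l : V) {i j m : V} (p : Quiver.Path i j) (f : j ⟶ m) :
    aug l (path (p.cons f) : PathAlgebra k V) = 0 := by
  simp [aug, lift_path, pathVal]

lemma aug_arrow (l : V) {i j : V} (f : i ⟶ j) : aug l (arrow k f) = 0 :=
  aug_cons l _ f

lemma aug_surjective (i : V) : Function.Surjective (aug (k := k) i) := fun c =>
  ⟨algebraMap k _ c, (aug i).commutes c⟩

lemma arrow_mem {i j : V} (f : i ⟶ j) : arrow k f ∈ arrowIdeal k V :=
  TwoSidedIdeal.subset_span ⟨i, j, f, rfl⟩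

lemma aug_eq_zero_of_mem (i : V) {x : PathAlgebra k V} (hx : x ∈ arrowIdeal k V) :
    aug i x = 0 := by
  have h : TwoSidedIdeal.span {x | ∃ (i j : V) (f : i ⟶ j), x = arrow k f} ≤
      TwoSidedIdeal.ker (aug (k := k) i) := by
    rw [TwoSidedIdeal.span_le]
    rintro _ ⟨j, l, f, rfl⟩
    exact (TwoSidedIdeal.mem_ker _).2 (aug_arrow i f)
  exact (TwoSidedIdeal.mem_ker _).1 (h hx)

/-! ### Coefficients of arrows -/

open Classical in
/-- The coefficient of an arrow. -/
def coeff {s t : V} (f : s ⟶ t) : PathAlgebra k V →ₗ[k] k :=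
  linearLift fun i j q =>
    if (⟨i, j, q⟩ : Σ i j : V, Quiver.Path i j) = ⟨s, t, f.toPath⟩ then 1 else 0

lemma coeff_arrow_self {s t : V} (f : s ⟶ t) : coeff f (arrow k f) = 1 := by
  simp [coeff, arrow]

lemma coeff_of_length_ne {s t : V} (f : s ⟶ t) {i j : V} (p : Quiver.Path i j)
    (hp : p.length ≠ 1) : coeff f (path p : PathAlgebra k V) = 0 := by
  rw [coeff, linearLift_path, if_neg]
  intro h
  obtain ⟨rfl, h⟩ := Sigma.mk.inj_iff.1 h
  obtain ⟨rfl, h⟩ := Sigma.mk.inj_iff.1 (eq_of_heq h)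
  obtain rfl := eq_of_heq h
  exact hp rfl

lemma coeff_of_source_ne {s t : V} (f : s ⟶ t) {i j : V} (p : Quiver.Path i j)
    (hp : i ≠ s) : coeff f (path p : PathAlgebra k V) = 0 := by
  rw [coeff, linearLift_path, if_neg]
  intro h
  exact hp (Sigma.mk.inj_iff.1 h).1

lemma coeff_of_target_ne {s t : V} (f : s ⟶ t) {i j : V} (p : Quiver.Path i j)
    (hp : j ≠ t) : coeff f (path p : PathAlgebra k V) = 0 := by
  rw [coeff, linearLift_path, if_neg]
  intro h
  obtain ⟨rfl, h⟩ := Sigma.mk.inj_iff.1 h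
  exact hp (Sigma.mk.inj_iff.1 (eq_of_heq h)).1

lemma coeff_arrow_of_ne {s t i j : V} (f : s ⟶ t) (g : i ⟶ j)
    (h : (⟨i, j, g⟩ : Σ i j : V, (i ⟶ j)) ≠ ⟨s, t, f⟩) : coeff f (arrow k g) = 0 := by
  rw [coeff, arrow, linearLift_path, if_neg]
  intro h'
  obtain ⟨rfl, h'⟩ := Sigma.mk.inj_iff.1 h'
  obtain ⟨rfl, h'⟩ := Sigma.mk.inj_iff.1 (eq_of_heq h')
  have h'' := eq_of_heq h'
  rw [Quiver.Hom.toPath, Quiver.Hom.toPath, Quiver.Path.cons.injEq] at h''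
  exact h (by rw [eq_of_heq h''.2.2])

lemma coeff_mul {s t : V} (f : s ⟶ t) (x y : PathAlgebra k V) :
    coeff f (x * y) = aug t x * coeff f y + coeff f x * aug s y := by
  suffices h : (mulLin (k := k) (V := V)).compr₂ (coeff f) =
      (LinearMap.mul k k).compl₁₂ (aug t).toLinearMap (coeff f) +
      (LinearMap.mul k k).compl₁₂ (coeff f) (aug s).toLinearMap from
    LinearMap.congr_fun (LinearMap.congr_fun h x) y
  refine linear_ext fun i' j' q => linear_ext fun i j p => ?_
  simp only [LinearMap.compr₂_apply, LinearMap.compl₁₂_apply, LinearMap.add_apply,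
    LinearMap.mul_apply', ← mul_def, AlgHom.toLinearMap_apply]
  cases q with
  | nil =>
    rw [coeff_of_length_ne f (Quiver.Path.nil : Quiver.Path i' i') (by simp), zero_mul, add_zero]
    by_cases h : i' = t
    · subst h
      rw [show aug i' (path Quiver.Path.nil : PathAlgebra k V) = 1 from aug_vertex_self i',
        one_mul]
      by_cases hj : j = i'
      · subst hj; rw [path_mul_path, Quiver.Path.comp_nil]
      · rw [path_mul_path_of_ne _ _ hj, coeff_of_target_ne f p hj, map_zero]
    · rw [show aug t (path (Quiver.Path.nil : Quiver.Path i' i') : PathAlgebra k V) = 0 from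
        aug_vertex_of_ne (k := k) h, zero_mul]
      by_cases hj : j = i'
      · subst hj; rw [path_mul_path, Quiver.Path.comp_nil, coeff_of_target_ne f p h]
      · rw [path_mul_path_of_ne _ _ hj, map_zero]
  | cons q g =>
    rw [aug_cons, zero_mul, zero_add]
    cases p with
    | nil =>
      by_cases hi : i = i'
      · subst hi
        rw [path_mul_path, Quiver.Path.nil_comp]
        by_cases h : i = s
        · subst h
          rw [show aug i (path Quiver.Path.nil : PathAlgebra k V) = 1 from aug_vertex_self i,
            mul_one]
        · rw [coeff_of_source_ne f _ h, zero_mul]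
      · rw [path_mul_path_of_ne _ _ hi, map_zero]
        by_cases h : i = s
        · subst h
          rw [coeff_of_source_ne f _ (Ne.symm hi), zero_mul]
        · rw [show aug s (path (Quiver.Path.nil : Quiver.Path i i) : PathAlgebra k V) = 0 from
            aug_vertex_of_ne (k := k) h, mul_zero]
    | cons p g' =>
      rw [aug_cons, mul_zero]
      by_cases hj : j = i'
      · subst hj
        rw [path_mul_path, Quiver.Path.comp_cons, coeff_of_length_ne f _ (by simp)]
      · rw [path_mul_path_of_ne _ _ hj, map_zero]

lemma aug_eq_zero_of_mem_sq (i : V) {x : PathAlgebra k V} (hx : x ∈ arrowIdeal k V ^ 2) :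
    aug i x = 0 :=
  aug_eq_zero_of_mem i (Ideal.pow_le_self two_ne_zero hx)

lemma sq_eq_mul : arrowIdeal k V ^ 2 = arrowIdeal k V * arrowIdeal k V := by
  rw [Submodule.pow_succ, Submodule.pow_one]

lemma coeff_eq_zero_of_mem_sq {s t : V} (f : s ⟶ t) {x : PathAlgebra k V}
    (hx : x ∈ arrowIdeal k V ^ 2) : coeff f x = 0 := by
  rw [sq_eq_mul] at hx
  refine Submodule.smul_induction_on hx ?_ ?_
  · intro r hr y hy
    rw [smul_eq_mul, coeff_mul, aug_eq_zero_of_mem t hr, aug_eq_zero_of_mem s hy]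
    simp
  · intro x y hx hy
    rw [map_add, hx, hy, add_zero]

end PathAlgebra

/-! ## The radical square zero algebra -/

/-- The type of arrows of a quiver. -/
abbrev Arrow (V : Type v) [Quiver.{w} V] : Type (max v w) := Σ i j : V, (i ⟶ j)

variable (k : Type u) [Field k] (V : Type v) [Quiver.{w} V] [Finite V]

/-- The radical square zero algebra `kQ/J²` of a finite quiver. -/
abbrev RadSq : Type (max u v w) := PathAlgebra k V ⧸ (PathAlgebra.arrowIdeal k V ^ 2)

namespace RadSq

variable {V}

/-- The idempotent of `kQ/J²` at a vertex. -/
def vertex (i : V) : RadSq k V := Ideal.Quotient.mk _ (PathAlgebra.vertex k i)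

/-- The element of `kQ/J²` given by an arrow. -/
def arrow (a : Arrow V) : RadSq k V := Ideal.Quotient.mk _ (PathAlgebra.arrow k a.2.2)

variable {k}

/-- The augmentation of `kQ/J²` at a vertex. -/
def aug (i : V) : RadSq k V →+* k :=
  Ideal.Quotient.lift _ (PathAlgebra.aug i).toRingHom
    fun _ hx => PathAlgebra.aug_eq_zero_of_mem_sq i hx

/-- The coefficient of an arrow in an element of `kQ/J²`. -/
def coeff (a : Arrow V) : RadSq k V →+ k :=
  QuotientAddGroup.lift _ (PathAlgebra.coeff a.2.2).toAddMonoidHom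
    fun _ hx => PathAlgebra.coeff_eq_zero_of_mem_sq a.2.2 hx

lemma exists_mk (x : RadSq k V) : ∃ y : PathAlgebra k V, Ideal.Quotient.mk _ y = x :=
  Ideal.Quotient.mk_surjective x

lemma aug_mk (i : V) (x : PathAlgebra k V) :
    aug i (Ideal.Quotient.mk _ x : RadSq k V) = PathAlgebra.aug i x := rfl

lemma coeff_mk (a : Arrow V) (x : PathAlgebra k V) :
    coeff a (Ideal.Quotient.mk _ x : RadSq k V) = PathAlgebra.coeff a.2.2 x := rfl

lemma aug_vertex_self (i : V) : aug i (vertex k i) = 1 := PathAlgebra.aug_vertex_self i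

lemma aug_vertex_of_ne {i j : V} (h : j ≠ i) : aug i (vertex k j) = 0 :=
  PathAlgebra.aug_vertex_of_ne h

lemma aug_arrow (i : V) (a : Arrow V) : aug i (arrow k a) = 0 := PathAlgebra.aug_arrow i a.2.2

lemma aug_algebraMap (i : V) (c : k) : aug i (algebraMap k (RadSq k V) c) = c :=
  (PathAlgebra.aug i).commutes c

lemma coeff_arrow_self (a : Arrow V) : coeff a (arrow k a) = 1 :=
  PathAlgebra.coeff_arrow_self a.2.2

lemma coeff_arrow_of_ne {a b : Arrow V} (h : b ≠ a) : coeff a (arrow k b) = 0 :=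
  PathAlgebra.coeff_arrow_of_ne a.2.2 b.2.2 h

lemma coeff_mul (a : Arrow V) (x y : RadSq k V) :
    coeff a (x * y) = aug a.2.1 x * coeff a y + coeff a x * aug a.1 y := by
  obtain ⟨x, rfl⟩ := exists_mk x
  obtain ⟨y, rfl⟩ := exists_mk y
  exact PathAlgebra.coeff_mul a.2.2 x y

lemma vertex_mul_self (i : V) : vertex k i * vertex k i = vertex k i := by
  rw [vertex, ← map_mul, PathAlgebra.vertex, PathAlgebra.path_mul_path, Quiver.Path.nil_comp]

lemma vertex_mul_of_ne {i j : V} (h : i ≠ j) : vertex k i * vertex k j = 0 := by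
  rw [vertex, vertex, ← map_mul, PathAlgebra.vertex, PathAlgebra.vertex,
    PathAlgebra.path_mul_path_of_ne _ _ (Ne.symm h), map_zero]

lemma sum_vertex : ∑ᶠ i : V, vertex k i = 1 := by
  let _ := Fintype.ofFinite V
  rw [← map_one (Ideal.Quotient.mk (PathAlgebra.arrowIdeal k V ^ 2)), PathAlgebra.one_def,
    finsum_eq_sum_of_fintype, finsum_eq_sum_of_fintype, map_sum]
  rfl

lemma vertex_mul_arrow (a : Arrow V) : vertex k a.2.1 * arrow k a = arrow k a := by
  rw [vertex, arrow, ← map_mul, PathAlgebra.vertex, PathAlgebra.arrow, PathAlgebra.path_mul_path,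
    Quiver.Path.comp_nil]

lemma arrow_mul_vertex (a : Arrow V) : arrow k a * vertex k a.1 = arrow k a := by
  rw [vertex, arrow, ← map_mul, PathAlgebra.vertex, PathAlgebra.arrow, PathAlgebra.path_mul_path,
    Quiver.Path.nil_comp]

lemma vertex_mul_arrow_of_ne {i : V} {a : Arrow V} (h : a.2.1 ≠ i) :
    vertex k i * arrow k a = 0 := by
  rw [← vertex_mul_arrow, ← mul_assoc, vertex_mul_of_ne (Ne.symm h), zero_mul]

lemma arrow_mul_arrow (a b : Arrow V) : arrow k a * arrow k b = 0 := by
  rw [arrow, arrow, ← map_mul, Ideal.Quotient.eq_zero_iff_mem, PathAlgebra.sq_eq_mul]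
  exact Ideal.mul_mem_mul (PathAlgebra.arrow_mem _) (PathAlgebra.arrow_mem _)

lemma aug_of_mem_jacobson {x : RadSq k V} (hx : x ∈ Ring.jacobson (RadSq k V)) (i : V) :
    aug i x = 0 := by
  have hs : Function.Surjective (aug (k := k) i) := fun c => ⟨_, aug_algebraMap i c⟩
  have := RingHom.ker_isMaximal_of_surjective (aug (k := k) i) hs
  exact Ring.jacobson_le_of_isMaximal (RingHom.ker (aug (k := k) i)) hx

variable [∀ i j : V, Finite (i ⟶ j)]

/-- Every element is a combination of trivial paths and arrows. -/
lemma eq_sum (x : RadSq k V) :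
    x = ∑ᶠ i : V, algebraMap k _ (aug i x) * vertex k i +
      ∑ᶠ a : Arrow V, algebraMap k _ (coeff a x) * arrow k a := by
  classical
  let _ := Fintype.ofFinite V
  let _ := Fintype.ofFinite (Arrow V)
  obtain ⟨y, rfl⟩ := exists_mk x
  simp only [finsum_eq_sum_of_fintype, ← Algebra.smul_def]
  let π : PathAlgebra k V →ₗ[k] RadSq k V :=
    (Ideal.Quotient.mkₐ k (PathAlgebra.arrowIdeal k V ^ 2)).toLinearMap
  suffices h : π = ∑ i : V, (PathAlgebra.aug i).toLinearMap.smulRight (vertex k i) +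
      ∑ a : Arrow V, (PathAlgebra.coeff a.2.2).smulRight (arrow k a) by
    have h' := LinearMap.congr_fun h y
    simp only [LinearMap.add_apply, LinearMap.sum_apply, LinearMap.smulRight_apply] at h'
    exact h'
  refine PathAlgebra.linear_ext fun i j p => ?_
  simp only [LinearMap.add_apply, LinearMap.sum_apply, LinearMap.smulRight_apply,
    AlgHom.toLinearMap_apply]
  cases p with
  | nil =>
    rw [Finset.sum_eq_single i, Finset.sum_eq_zero, add_zero]
    · rw [show PathAlgebra.aug i (PathAlgebra.path (k := k) (Quiver.Path.nil : Quiver.Path i i)) = 1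
        from PathAlgebra.aug_vertex_self i, one_smul]
      rfl
    · intro a _
      rw [PathAlgebra.coeff_of_length_ne _ _ (by simp), zero_smul]
    · intro j _ hj
      rw [show PathAlgebra.aug j (PathAlgebra.path (k := k) (Quiver.Path.nil : Quiver.Path i i)) = 0
        from PathAlgebra.aug_vertex_of_ne (Ne.symm hj), zero_smul]
    · simp
  | @cons l _ p f =>
    rw [Finset.sum_eq_zero (fun m _ => by rw [PathAlgebra.aug_cons, zero_smul]), zero_add]
    cases p with
    | nil =>
      rw [Finset.sum_eq_single ⟨i, j, f⟩]
      · exact (one_smul k _).symm.trans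
          (congrArg (· • arrow k (⟨i, j, f⟩ : Arrow V)) (PathAlgebra.coeff_arrow_self f).symm)
      · intro b _ hb
        rw [show PathAlgebra.coeff b.2.2 (PathAlgebra.path (Quiver.Path.nil.cons f)) = (0 : k) from
          PathAlgebra.coeff_arrow_of_ne b.2.2 f (Ne.symm hb), zero_smul]
      · simp
    | cons p g =>
      rw [Finset.sum_eq_zero fun a _ => by
        rw [PathAlgebra.coeff_of_length_ne _ _ (by simp), zero_smul]]
      refine (Ideal.Quotient.eq_zero_iff_mem).2 ?_
      rw [PathAlgebra.path_cons, PathAlgebra.path_cons, ← mul_assoc, PathAlgebra.sq_eq_mul]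
      exact Ideal.mul_mem_right _ _
        (Ideal.mul_mem_mul (PathAlgebra.arrow_mem _) (PathAlgebra.arrow_mem _))

/-- An element whose augmentations vanish is a combination of arrows. -/
lemma eq_sum_arrow {x : RadSq k V} (hx : ∀ i, aug i x = 0) :
    x = ∑ᶠ a : Arrow V, algebraMap k _ (coeff a x) * arrow k a := by
  conv_lhs => rw [eq_sum x]
  simp [hx]

lemma mul_eq_zero_of_aug {x y : RadSq k V} (hx : ∀ i, aug i x = 0) (hy : ∀ i, aug i y = 0) :
    x * y = 0 := by
  let _ := Fintype.ofFinite (Arrow V)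
  rw [eq_sum_arrow hx, eq_sum_arrow hy, finsum_eq_sum_of_fintype, finsum_eq_sum_of_fintype,
    Finset.sum_mul_sum]
  refine Finset.sum_eq_zero fun a _ => Finset.sum_eq_zero fun b _ => ?_
  rw [mul_assoc, ← mul_assoc (arrow k a), ← Algebra.commutes, mul_assoc, arrow_mul_arrow]
  simp

lemma mem_jacobson_of_aug {x : RadSq k V} (hx : ∀ i, aug i x = 0) :
    x ∈ Ring.jacobson (RadSq k V) := by
  rw [← Ideal.jacobson_bot, Ideal.mem_jacobson_iff]
  intro y
  refine ⟨1 - y * x, ?_⟩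
  have h : y * x * (y * x) = 0 :=
    mul_eq_zero_of_aug (fun i => by simp [hx]) (fun i => by simp [hx])
  have : (1 - y * x) * y * x + (1 - y * x) - 1 = - (y * x * (y * x)) := by noncomm_ring
  rw [this, h]
  simp

end RadSq

/-! ## Differential projective modules -/

/-- A differential projective module over a ring `Λ`: a projective `Λ`-module with an
endomorphism `d` such that `d² = 0`. -/
structure DiffProj (Λ : Type u) [Ring Λ] : Type (max u (t + 1)) where
  carrier : Type t
  [addCommGroup : AddCommGroup carrier]
  [module : Module Λ carrier]
  [projective : Module.Projective Λ carrier]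
  d : carrier →ₗ[Λ] carrier
  d_d : ∀ x, d (d x) = 0

namespace DiffProj

variable {Λ : Type u} [Ring Λ]

instance : CoeSort (DiffProj.{u, t} Λ) (Type t) := ⟨carrier⟩

attribute [instance] addCommGroup module projective

/-- Morphisms of differential projective modules: module maps commuting with the
differentials. -/
@[ext]
structure Hom (M N : DiffProj.{u, t} Λ) : Type t where
  lin : M →ₗ[Λ] N
  comm : ∀ x, lin (M.d x) = N.d (lin x)

instance : Category (DiffProj.{u, t} Λ) where
  Hom M N := Hom M N
  id M := ⟨LinearMap.id, fun _ => rfl⟩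
  comp f g := ⟨g.lin ∘ₗ f.lin, fun x => by simp [f.comm, g.comm]⟩

/-- The underlying linear map of a morphism. -/
abbrev lin {M N : DiffProj.{u, t} Λ} (f : M ⟶ N) : M →ₗ[Λ] N := Hom.lin f

@[ext] lemma hom_ext {M N : DiffProj.{u, t} Λ} {f g : M ⟶ N} (h : ∀ x, lin f x = lin g x) :
    f = g := Hom.ext (LinearMap.ext h)

@[simp] lemma lin_id (M : DiffProj.{u, t} Λ) (x : M) : lin (𝟙 M) x = x := rfl

@[simp] lemma lin_comp {M N P : DiffProj.{u, t} Λ} (f : M ⟶ N) (g : N ⟶ P) (x : M) :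
    lin (f ≫ g) x = lin g (lin f x) := rfl

lemma lin_comm {M N : DiffProj.{u, t} Λ} (f : M ⟶ N) (x : M) :
    lin f (M.d x) = N.d (lin f x) := Hom.comm f x

section

variable {M N : DiffProj.{u, t} Λ}

instance : Zero (M ⟶ N) := ⟨⟨0, by simp⟩⟩
instance : Add (M ⟶ N) := ⟨fun f g => ⟨lin f + lin g, by simp [lin_comm]⟩⟩
instance : Neg (M ⟶ N) := ⟨fun f => ⟨-lin f, by simp [lin_comm]⟩⟩
instance : Sub (M ⟶ N) := ⟨fun f g => ⟨lin f - lin g, by simp [lin_comm]⟩⟩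
instance : SMul ℕ (M ⟶ N) := ⟨fun n f => ⟨n • lin f, by simp [lin_comm]⟩⟩
instance : SMul ℤ (M ⟶ N) := ⟨fun n f => ⟨n • lin f, by simp [lin_comm]⟩⟩

instance : AddCommGroup (M ⟶ N) :=
  Function.Injective.addCommGroup (fun f : M ⟶ N => lin f) (fun _ _ h => Hom.ext h)
    rfl (fun _ _ => rfl) (fun _ => rfl) (fun _ _ => rfl) (fun _ _ => rfl) (fun _ _ => rfl)

@[simp] lemma lin_zero (x : M) : lin (0 : M ⟶ N) x = 0 := rfl
@[simp] lemma lin_add (f g : M ⟶ N) (x : M) : lin (f + g) x = lin f x + lin g x := rfl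
@[simp] lemma lin_sub (f g : M ⟶ N) (x : M) : lin (f - g) x = lin f x - lin g x := rfl

end

instance : Preadditive (DiffProj.{u, t} Λ) where
  add_comp _ _ _ f g h := by ext x; exact map_add (lin h) (lin f x) (lin g x)
  comp_add _ _ _ f g h := rfl

/-- The direct sum of two differential projective modules. -/
def directSum (M N : DiffProj.{u, t} Λ) : DiffProj.{u, t} Λ where
  carrier := M × N
  d := LinearMap.prodMap M.d N.d
  d_d x := by ext <;> simp [M.d_d, N.d_d]

/-- The direct sum of two differential projective modules, as a bicone. -/
def bicone (M N : DiffProj.{u, t} Λ) : BinaryBicone M N where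
  pt := directSum M N
  fst := ⟨LinearMap.fst Λ M N, fun _ => rfl⟩
  snd := ⟨LinearMap.snd Λ M N, fun _ => rfl⟩
  inl := ⟨LinearMap.inl Λ M N, fun x => by
    refine Prod.ext rfl ?_
    exact (map_zero N.d).symm⟩
  inr := ⟨LinearMap.inr Λ M N, fun x => by
    refine Prod.ext ?_ rfl
    exact (map_zero M.d).symm⟩
  inl_fst := rfl
  inl_snd := rfl
  inr_fst := rfl
  inr_snd := rfl

/-- The direct sum is a biproduct. -/
def biconeIsBilimit (M N : DiffProj.{u, t} Λ) : (bicone M N).IsBilimit :=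
  isBinaryBilimitOfTotal _ <| by
    ext x
    exact Prod.ext (add_zero _) (zero_add _)

instance : HasBinaryBiproducts (DiffProj.{u, t} Λ) where
  has_binary_biproduct M N := HasBinaryBiproduct.mk ⟨bicone M N, biconeIsBilimit M N⟩

/-! ### Null homotopic maps, contractible and reduced objects -/

/-- A module map `f : M → N` between differential modules is null homotopic if `f = r d + δ r` for
some module map `r : M → N`. -/
def NullHomotopic {M N : DiffProj.{u, t} Λ} (f : M →ₗ[Λ] N) : Prop :=
  ∃ r : M →ₗ[Λ] N, f = r ∘ₗ M.d + N.d ∘ₗ r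

/-- A differential module is contractible if its identity map is null homotopic. -/
def Contractible (M : DiffProj.{u, t} Λ) : Prop :=
  NullHomotopic (LinearMap.id : M →ₗ[Λ] M)

variable (Λ) in
/-- A differential projective module is reduced if it has no nonzero contractible direct
summands. -/
def IsReducedObj : ObjectProperty (DiffProj.{u, t} Λ) := fun M =>
  ∀ N N' : DiffProj.{u, t} Λ, Nonempty (M ≅ N ⊞ N') → Contractible N → Subsingleton N

variable (Λ) in
/-- The category of reduced differential projective modules. -/
abbrev Reduced := (IsReducedObj.{u, t} Λ).FullSubcategory

/-! ### The homotopy category -/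

variable (Λ) in
/-- Two morphisms are homotopic if their difference is null homotopic. -/
def homotopyRel : HomRel (DiffProj.{u, t} Λ) := fun _ _ f g => NullHomotopic (lin f - lin g)

lemma NullHomotopic.zero {M N : DiffProj.{u, t} Λ} : NullHomotopic (0 : M →ₗ[Λ] N) :=
  ⟨0, by simp⟩

lemma NullHomotopic.add {M N : DiffProj.{u, t} Λ} {f g : M →ₗ[Λ] N} (hf : NullHomotopic f)
    (hg : NullHomotopic g) : NullHomotopic (f + g) := by
  obtain ⟨r, rfl⟩ := hf
  obtain ⟨s, rfl⟩ := hg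
  exact ⟨r + s, by rw [LinearMap.add_comp, LinearMap.comp_add]; abel⟩

lemma NullHomotopic.neg {M N : DiffProj.{u, t} Λ} {f : M →ₗ[Λ] N} (hf : NullHomotopic f) :
    NullHomotopic (-f) := by
  obtain ⟨r, rfl⟩ := hf
  exact ⟨-r, by rw [LinearMap.neg_comp, LinearMap.comp_neg]; abel⟩

instance : Congruence (homotopyRel.{u, t} Λ) where
  equivalence :=
    { refl := fun f => by
        rw [homotopyRel, sub_self]; exact NullHomotopic.zero
      symm := fun {f g} h => by
        rw [homotopyRel, ← neg_sub]; exact h.neg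
      trans := fun {f g h} h₁ h₂ => by
        rw [homotopyRel, ← sub_add_sub_cancel _ (lin g)]; exact NullHomotopic.add h₁ h₂ }
  comp_left := by
    rintro M N P f g g' ⟨r, hr⟩
    refine ⟨r ∘ₗ lin f, LinearMap.ext fun x => ?_⟩
    simpa [lin_comm] using LinearMap.congr_fun hr (lin f x)
  comp_right := by
    rintro M N P f f' g ⟨r, hr⟩
    refine ⟨lin g ∘ₗ r, LinearMap.ext fun x => ?_⟩
    simpa [lin_comm] using congrArg (lin g) (LinearMap.congr_fun hr x)

variable (Λ) in
/-- The homotopy category of differential projective modules: the objects are the differential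
projective modules and the morphisms are the homotopy classes of morphisms. -/
abbrev HomotopyCat := CategoryTheory.Quotient (homotopyRel.{u, t} Λ)

lemma homotopyRel_add ⦃M N : DiffProj.{u, t} Λ⦄ (f₁ f₂ g₁ g₂ : M ⟶ N)
    (hf : homotopyRel Λ f₁ f₂) (hg : homotopyRel Λ g₁ g₂) :
    homotopyRel Λ (f₁ + g₁) (f₂ + g₂) := by
  have := NullHomotopic.add hf hg
  rwa [sub_add_sub_comm] at this

instance : Preadditive (HomotopyCat.{u, t} Λ) :=
  CategoryTheory.Quotient.preadditive _ homotopyRel_add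

variable (Λ) in
/-- The functor from differential projective modules to the homotopy category. -/
abbrev toHomotopy : DiffProj.{u, t} Λ ⥤ HomotopyCat.{u, t} Λ :=
  CategoryTheory.Quotient.functor (homotopyRel.{u, t} Λ)

instance : (toHomotopy.{u, t} Λ).Additive :=
  CategoryTheory.Quotient.functor_additive _ homotopyRel_add

instance : HasBinaryBiproducts (HomotopyCat.{u, t} Λ) where
  has_binary_biproduct X Y :=
    have := preservesBinaryBiproduct_of_preservesBiproduct (toHomotopy Λ) X.as Y.as
    HasBinaryBiproduct.mk ⟨(toHomotopy Λ).mapBinaryBicone (bicone X.as Y.as),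
      isBinaryBilimitOfPreserves _ (biconeIsBilimit X.as Y.as)⟩

end DiffProj

open DiffProj

/-! ### Splitting off contractible summands -/

section Split

variable {Λ : Type u} [Ring Λ] {M : DiffProj.{u, t} Λ}

/-- The image of an idempotent endomorphism. -/
def imageObj (π : M →ₗ[Λ] M) (hπ : ∀ x, π (π x) = π x) (hd : ∀ x, π (M.d x) = M.d (π x)) :
    DiffProj.{u, t} Λ where
  carrier := LinearMap.range π
  projective := Module.Projective.of_split (LinearMap.range π).subtype π.rangeRestrict (by
    ext ⟨_, x, rfl⟩
    exact hπ x)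
  d := M.d.restrict (by
    rintro _ ⟨x, rfl⟩
    exact ⟨M.d x, hd x⟩)
  d_d x := Subtype.ext (M.d_d x)

/-- An idempotent endomorphism decomposes an object as a direct sum. -/
lemma nonempty_iso_image (π : M →ₗ[Λ] M) (hπ : ∀ x, π (π x) = π x)
    (hd : ∀ x, π (M.d x) = M.d (π x)) :
    ∃ N' : DiffProj.{u, t} Λ, Nonempty (M ≅ imageObj π hπ hd ⊞ N') := by
  let π' : M →ₗ[Λ] M := LinearMap.id - π
  have hπ' : ∀ x, π' (π' x) = π' x := fun x => by simp [π', hπ]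
  have hd' : ∀ x, π' (M.d x) = M.d (π' x) := fun x => by simp [π', hd]
  let b : BinaryBicone (imageObj π hπ hd) (imageObj π' hπ' hd') :=
    { pt := M
      fst := ⟨π.rangeRestrict, fun x => Subtype.ext (hd x)⟩
      snd := ⟨π'.rangeRestrict, fun x => Subtype.ext (hd' x)⟩
      inl := ⟨(LinearMap.range π).subtype, fun x => rfl⟩
      inr := ⟨(LinearMap.range π').subtype, fun x => rfl⟩
      inl_fst := by
        ext ⟨_, x, rfl⟩
        exact Subtype.ext (hπ x)
      inl_snd := by
        ext ⟨_, x, rfl⟩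
        refine Subtype.ext ?_
        change π x - π (π x) = 0
        rw [hπ, sub_self]
      inr_fst := by
        ext ⟨_, x, rfl⟩
        refine Subtype.ext ?_
        change π (x - π x) = 0
        rw [map_sub, hπ, sub_self]
      inr_snd := by
        ext ⟨_, x, rfl⟩
        exact Subtype.ext (hπ' x) }
  have hb : b.IsBilimit := isBinaryBilimitOfTotal b (by
    ext x
    change π x + (x - π x) = x
    abel)
  exact ⟨_, ⟨biprod.uniqueUpToIso _ _ hb⟩⟩

/-- A null homotopic idempotent endomorphism of a reduced object is zero. -/
lemma eq_zero_of_reduced (hM : IsReducedObj Λ M) (s : M →ₗ[Λ] M)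
    (hπ : ∀ x, (s ∘ₗ M.d + M.d ∘ₗ s) ((s ∘ₗ M.d + M.d ∘ₗ s) x) = (s ∘ₗ M.d + M.d ∘ₗ s) x) :
    s ∘ₗ M.d + M.d ∘ₗ s = 0 := by
  set π : M →ₗ[Λ] M := s ∘ₗ M.d + M.d ∘ₗ s with hdef
  have hπd : ∀ x, π x = s (M.d x) + M.d (s x) := fun x => rfl
  have hd : ∀ x, π (M.d x) = M.d (π x) := fun x => by simp [hπd, M.d_d]
  obtain ⟨N', hN'⟩ := nonempty_iso_image π hπ hd
  have hc : Contractible (imageObj π hπ hd) := by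
    refine ⟨π.rangeRestrict ∘ₗ s ∘ₗ (LinearMap.range π).subtype, ?_⟩
    ext ⟨_, x, rfl⟩
    refine Subtype.ext ?_
    change π x = π (s (M.d (π x))) + M.d (π (s (π x)))
    rw [← hd (s (π x)), ← map_add]
    change π x = π (π (π x))
    rw [hπ, hπ]
  have : Subsingleton (LinearMap.range π) := hM _ _ hN' hc
  ext x
  exact congrArg Subtype.val (Subsingleton.elim (α := LinearMap.range π) ⟨π x, x, rfl⟩ 0)

end Split

/-! ### The radical of a projective module over `kQ/J²` -/

section Radical

variable {k : Type u} [Field k] {V : Type v} [Quiver.{w} V] [Finite V]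
  [∀ i j : V, Finite (i ⟶ j)]
variable {M : Type t} [AddCommGroup M] [Module (RadSq k V) M]

open RadSq

lemma arrow_smul_mem (a : Arrow V) (x : M) :
    arrow k a • x ∈ Module.jacobson (RadSq k V) M :=
  Ring.jacobson_smul_top_le _ _ (Submodule.smul_mem_smul
    (mem_jacobson_of_aug fun i => aug_arrow i a) Submodule.mem_top)

lemma aug_of_mem {x : M} (hx : x ∈ Module.jacobson (RadSq k V) M) (f : M →ₗ[RadSq k V] RadSq k V)
    (i : V) : aug i (f x) = 0 :=
  aug_of_mem_jacobson (Module.le_comap_jacobson f hx) i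

lemma mem_of_aug [Module.Projective (RadSq k V) M] {x : M}
    (h : ∀ (f : M →ₗ[RadSq k V] RadSq k V) (i : V), aug i (f x) = 0) :
    x ∈ Ring.jacobson (RadSq k V) • (⊤ : Submodule (RadSq k V) M) := by
  obtain ⟨s, hs⟩ := Module.Projective.out (R := RadSq k V) (P := M)
  rw [← hs x, Finsupp.linearCombination_apply]
  refine Submodule.sum_mem _ fun b _ => Submodule.smul_mem_smul ?_ Submodule.mem_top
  exact mem_jacobson_of_aug fun i => h (Finsupp.lapply b ∘ₗ s) i

lemma mem_rad_of_aug [Module.Projective (RadSq k V) M] {x : M}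
    (h : ∀ (f : M →ₗ[RadSq k V] RadSq k V) (i : V), aug i (f x) = 0) :
    x ∈ Module.jacobson (RadSq k V) M :=
  Ring.jacobson_smul_top_le _ _ (mem_of_aug h)

/-- `y` is a family of elements `y_α ∈ e_{s(α)} M` with `x = ∑_α α y_α`. -/
def IsCoord (x : M) (y : Arrow V → M) : Prop :=
  (∀ a, vertex k a.1 • y a = y a) ∧ x = ∑ᶠ a, arrow k a • y a

lemma finsum_smul_add (y z : Arrow V → M) :
    ∑ᶠ a, arrow k a • (y a + z a) = ∑ᶠ a, arrow k a • y a + ∑ᶠ a, arrow k a • z a := by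
  let _ := Fintype.ofFinite (Arrow V)
  simp [finsum_eq_sum_of_fintype, Finset.sum_add_distrib]

lemma IsCoord.add {x x' : M} {y y' : Arrow V → M} (h : IsCoord (k := k) x y)
    (h' : IsCoord (k := k) x' y') : IsCoord (k := k) (x + x') (fun a => y a + y' a) :=
  ⟨fun a => by rw [smul_add, h.1, h'.1], by rw [finsum_smul_add, ← h.2, ← h'.2]⟩

lemma IsCoord.neg {x : M} {y : Arrow V → M} (h : IsCoord (k := k) x y) :
    IsCoord (k := k) (-x) (fun a => -y a) := by
  refine ⟨fun a => by rw [smul_neg, h.1], ?_⟩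
  rw [h.2]
  simp [finsum_neg_distrib]

lemma IsCoord.scalar {x : M} {y : Arrow V → M} (h : IsCoord (k := k) x y) (c : k) :
    IsCoord (k := k) (algebraMap k (RadSq k V) c • x)
      (fun a => algebraMap k (RadSq k V) c • y a) := by
  let _ := Fintype.ofFinite (Arrow V)
  refine ⟨fun a => by rw [smul_smul, ← Algebra.commutes, mul_smul, h.1], ?_⟩
  conv_lhs => rw [h.2]
  simp only [finsum_eq_sum_of_fintype, Finset.smul_sum, smul_smul, Algebra.commutes]

lemma IsCoord.map {N : Type*} [AddCommGroup N] [Module (RadSq k V) N] {x : M} {y : Arrow V → M}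
    (h : IsCoord (k := k) x y) (f : M →ₗ[RadSq k V] N) :
    IsCoord (k := k) (f x) (fun a => f (y a)) := by
  let _ := Fintype.ofFinite (Arrow V)
  refine ⟨fun a => by rw [← map_smul, h.1], ?_⟩
  rw [h.2]
  simp [finsum_eq_sum_of_fintype]

lemma IsCoord.zero : IsCoord (k := k) (0 : M) (fun _ : Arrow V => 0) :=
  ⟨fun _ => smul_zero _, by simp⟩

open Classical in
lemma IsCoord.vertex {x : M} {y : Arrow V → M} (h : IsCoord (k := k) x y) (i : V) :
    IsCoord (k := k) (vertex k i • x) (fun a => if a.2.1 = i then y a else 0) := by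
  let _ := Fintype.ofFinite (Arrow V)
  refine ⟨fun a => ?_, ?_⟩
  · dsimp only
    split_ifs
    · exact h.1 a
    · exact smul_zero _
  · rw [h.2, finsum_eq_sum_of_fintype, finsum_eq_sum_of_fintype, Finset.smul_sum]
    refine Finset.sum_congr rfl fun a _ => ?_
    dsimp only
    split_ifs with ha
    · rw [smul_smul, ← ha, vertex_mul_arrow]
    · rw [smul_smul, vertex_mul_arrow_of_ne ha, zero_smul, smul_zero]

lemma exists_coord [Module.Projective (RadSq k V) M] {x : M}
    (hx : x ∈ Module.jacobson (RadSq k V) M) : ∃ y : Arrow V → M, IsCoord (k := k) x y := by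
  classical
  have hx' := mem_of_aug (k := k) (V := V) (fun f i => aug_of_mem (k := k) hx f i)
  refine Submodule.smul_induction_on hx' ?_ ?_
  · intro r hr m _
    refine ⟨fun a => vertex k a.1 • algebraMap k (RadSq k V) (coeff a r) • m, fun a => ?_, ?_⟩
    · rw [smul_smul, vertex_mul_self]
    · let _ := Fintype.ofFinite (Arrow V)
      conv_lhs => rw [eq_sum_arrow (fun i => aug_of_mem_jacobson hr i)]
      rw [finsum_eq_sum_of_fintype, finsum_eq_sum_of_fintype, Finset.sum_smul]
      refine Finset.sum_congr rfl fun a _ => ?_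
      rw [smul_smul, arrow_mul_vertex, smul_smul, Algebra.commutes]
  · rintro x x' ⟨y, hy⟩ ⟨y', hy'⟩
    exact ⟨_, hy.add hy'⟩

lemma IsCoord.mem [Module.Projective (RadSq k V) M] {y : Arrow V → M}
    (h : IsCoord (k := k) (0 : M) y) (a : Arrow V) : y a ∈ Module.jacobson (RadSq k V) M := by
  classical
  refine mem_rad_of_aug fun f i => ?_
  have hf := h.map f
  rw [map_zero] at hf
  by_cases hi : a.1 = i
  · subst hi
    let _ := Fintype.ofFinite (Arrow V)
    have h2 := congrArg (coeff a) hf.2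
    rw [map_zero, finsum_eq_sum_of_fintype, map_sum, Finset.sum_eq_single a] at h2
    · rw [smul_eq_mul, coeff_mul, aug_arrow, zero_mul, zero_add, coeff_arrow_self, one_mul] at h2
      exact h2.symm
    · intro b _ hb
      rw [smul_eq_mul, coeff_mul, aug_arrow, coeff_arrow_of_ne hb, zero_mul, zero_mul, add_zero]
    · simp
  · rw [← h.1 a, map_smul, smul_eq_mul, map_mul, aug_vertex_of_ne hi, zero_mul]

lemma arrow_smul_eq_zero [Module.Projective (RadSq k V) M] (a : Arrow V) {x : M}
    (hx : x ∈ Module.jacobson (RadSq k V) M) : arrow k a • x = 0 := by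
  obtain ⟨y, hy⟩ := exists_coord (k := k) hx
  let _ := Fintype.ofFinite (Arrow V)
  rw [hy.2, finsum_eq_sum_of_fintype, Finset.smul_sum]
  exact Finset.sum_eq_zero fun b _ => by rw [smul_smul, arrow_mul_arrow, zero_smul]

end Radical

/-! ### Reduced objects have radical differentials -/

section Functor

variable {k : Type u} [Field k] {V : Type v} [Quiver.{w} V] [Finite V]
  [∀ i j : V, Finite (i ⟶ j)]

open RadSq

lemma d_mem_of_reduced {M : DiffProj.{max u v w, t} (RadSq k V)}
    (hM : IsReducedObj (RadSq k V) M) (x : M) : M.d x ∈ Module.jacobson (RadSq k V) M := by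
  refine mem_rad_of_aug fun f i => ?_
  by_contra hc₀
  obtain ⟨e, he⟩ : ∃ e, e = vertex k i := ⟨_, rfl⟩
  have hee : e * e = e := by rw [he, vertex_mul_self]
  obtain ⟨x₁, hx₁⟩ : ∃ x₁, x₁ = e • x := ⟨_, rfl⟩
  obtain ⟨y, hy⟩ : ∃ y, y = M.d x₁ := ⟨_, rfl⟩
  have hdy : M.d y = 0 := by rw [hy, M.d_d]
  have hey : e • y = y := by rw [hy, hx₁, map_smul, smul_smul, hee]
  obtain ⟨c, hcdef⟩ : ∃ c, c = aug i (f (M.d x)) := ⟨_, rfl⟩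
  have hc : c ≠ 0 := hcdef ▸ hc₀
  have hfy : f y = e * f (M.d x) := by rw [hy, hx₁, map_smul, map_smul, smul_eq_mul]
  obtain ⟨z, hz⟩ : ∃ z : RadSq k V, z = algebraMap k _ c⁻¹ * e := ⟨_, rfl⟩
  obtain ⟨n, hn⟩ : ∃ n : RadSq k V, n = f y * z - e := ⟨_, rfl⟩
  have hze : z * e = z := by rw [hz, mul_assoc, hee]
  have hne : n * e = n := by rw [hn, sub_mul, mul_assoc, hze, hee]
  have hen : e * n = n := by rw [hn, mul_sub, ← mul_assoc, hfy, ← mul_assoc, hee]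
  have haug : ∀ j, aug j n = 0 := by
    intro j
    by_cases hj : i = j
    · subst hj
      rw [hn, hfy, hz, map_sub, map_mul, map_mul, map_mul, aug_algebraMap, he, aug_vertex_self,
        ← hcdef, one_mul, mul_one, mul_inv_cancel₀ hc, sub_self]
    · rw [← hen, map_mul, he, aug_vertex_of_ne hj, zero_mul]
  have hnn : n * n = 0 := mul_eq_zero_of_aug haug haug
  have hfyz : f y * z = e + n := by rw [hn]; abel
  let φ : M →ₗ[RadSq k V] RadSq k V :=
    LinearMap.toSpanSingleton (RadSq k V) (RadSq k V) (z * (e - n)) ∘ₗ f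
  have hφ : ∀ m, φ m = f m * (z * (e - n)) := fun m => rfl
  have hφe : ∀ m, φ m * e = φ m := fun m => by
    rw [hφ, mul_assoc, mul_assoc, sub_mul, hee, hne]
  have hφy : φ y = e := by
    rw [hφ, ← mul_assoc, hfyz, add_mul, mul_sub, mul_sub, hee, hen, hne, hnn]
    abel
  obtain ⟨x₂, hx₂⟩ : ∃ x₂, x₂ = x₁ - φ x₁ • y := ⟨_, rfl⟩
  have hdx₂ : M.d x₂ = y := by rw [hx₂, map_sub, map_smul, hdy, smul_zero, sub_zero, hy]
  have hφx₂ : φ x₂ = 0 := by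
    rw [hx₂, map_sub, map_smul, hφy, smul_eq_mul, hφe, sub_self]
  let s : M →ₗ[RadSq k V] M := LinearMap.toSpanSingleton (RadSq k V) M x₂ ∘ₗ φ
  have hs : ∀ m, (s ∘ₗ M.d + M.d ∘ₗ s) m = φ (M.d m) • x₂ + φ m • y := fun m => by
    change φ (M.d m) • x₂ + M.d (φ m • x₂) = _
    rw [map_smul, hdx₂]
  have h0 := eq_zero_of_reduced hM s (fun m => by
    rw [hs, hs]
    simp only [map_add, map_smul, hφx₂, hφy, hdx₂, hdy, smul_zero, mul_zero, zero_add, add_zero,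
      smul_eq_mul, hφe])
  have h1 := hs y
  rw [h0, hdy, map_zero, zero_smul, zero_add, hφy, hey] at h1
  apply hc
  have h1' : y = 0 := h1.symm
  have h2 : aug i (f y) = c := by
    rw [hfy, map_mul, he, aug_vertex_self, one_mul, hcdef]
  rw [← h2, h1', map_zero, map_zero]

/-! ### The functor `F` -/

instance {W : Type v} [Finite W] : Finite Wᵒᵖ := Finite.of_equiv W Opposite.equivToOpposite

/-- The top `M / rad M` of (the underlying module of) a reduced differential projective
`kQ/J²`-module. It carries the `kQ^op`-module structure defined below. -/
def ModTop (M : Reduced.{max u v w, t} (RadSq k V)) : Type t :=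
  M.obj ⧸ Module.jacobson (RadSq k V) M.obj

namespace ModTop

variable (M : Reduced.{max u v w, t} (RadSq k V))

instance : AddCommGroup (ModTop M) :=
  inferInstanceAs (AddCommGroup (M.obj ⧸ Module.jacobson (RadSq k V) M.obj))

instance : Module (RadSq k V) (ModTop M) :=
  inferInstanceAs (Module (RadSq k V) (M.obj ⧸ Module.jacobson (RadSq k V) M.obj))

instance : Module k (ModTop M) := Module.compHom (ModTop M) (algebraMap k (RadSq k V))

/-- The projection from a module to its top. -/
def mk : M.obj →ₗ[RadSq k V] ModTop M := (Module.jacobson (RadSq k V) M.obj).mkQ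

variable {M}

lemma mk_surjective : Function.Surjective (mk M) :=
  (Module.jacobson (RadSq k V) M.obj).mkQ_surjective

lemma mk_eq_zero {x : M.obj} : mk M x = 0 ↔ x ∈ Module.jacobson (RadSq k V) M.obj :=
  Submodule.Quotient.mk_eq_zero _

lemma scalar_def (c : k) (t : ModTop M) : c • t = algebraMap k (RadSq k V) c • t := rfl

lemma scalar_mk (c : k) (x : M.obj) : c • mk M x = mk M (algebraMap k (RadSq k V) c • x) :=
  (map_smul (mk M) _ x).symm

/-- If `d x = ∑_α α y_α` and `d x' = ∑_α α y'_α` with `y_α`, `y'_α` in `e_{s(α)} M`, and `x`, `x'`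
agree in the top, then `y_α`, `y'_α` agree in the top. -/
lemma coord_unique {x x' : M.obj} {y y' : Arrow V → M.obj} (hx : mk M x = mk M x')
    (hy : IsCoord (k := k) (M.obj.d x) y) (hy' : IsCoord (k := k) (M.obj.d x') y')
    (a : Arrow V) : mk M (y a) = mk M (y' a) := by
  have hmem : x - x' ∈ Module.jacobson (RadSq k V) M.obj := by
    rw [← mk_eq_zero, map_sub, hx, sub_self]
  have hd : M.obj.d (x - x') = 0 := by
    obtain ⟨z, hz⟩ := exists_coord (k := k) hmem
    let _ := Fintype.ofFinite (Arrow V)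
    rw [(hz.map M.obj.d).2, finsum_eq_sum_of_fintype]
    exact Finset.sum_eq_zero fun b _ => arrow_smul_eq_zero b (d_mem_of_reduced M.property _)
  have h := hy.add hy'.neg
  rw [← sub_eq_add_neg, ← map_sub, hd] at h
  have h' := mk_eq_zero.2 (h.mem a)
  rwa [← sub_eq_add_neg, map_sub, sub_eq_zero] at h'

lemma exists_gamma (t : ModTop M) : ∃ (x : M.obj) (y : Arrow V → M.obj), mk M x = t ∧
    IsCoord (k := k) (M.obj.d x) y := by
  obtain ⟨x, rfl⟩ := mk_surjective t
  obtain ⟨y, hy⟩ := exists_coord (k := k) (d_mem_of_reduced M.property x)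
  exact ⟨x, y, rfl, hy⟩

/-- The linear endomorphism of the top given by the differential and an arrow `α`: it sends the
class of `x` to the class of `y_α`, where `d x = ∑_β β y_β` with `y_β` in `e_{s(β)} M`. -/
def gamma (a : Arrow V) : ModTop M →ₗ[k] ModTop M where
  toFun t := mk M ((exists_gamma t).choose_spec.choose a)
  map_add' t t' := by
    have h := (exists_gamma t).choose_spec.choose_spec
    have h' := (exists_gamma t').choose_spec.choose_spec
    have h'' := (exists_gamma (t + t')).choose_spec.choose_spec
    have e := h.2.add h'.2
    rw [← map_add] at e
    exact (coord_unique (by rw [h''.1, map_add, h.1, h'.1]) h''.2 e a).trans (map_add _ _ _)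
  map_smul' c t := by
    have h := (exists_gamma t).choose_spec.choose_spec
    have h'' := (exists_gamma (c • t)).choose_spec.choose_spec
    have e := h.2.scalar c
    rw [← map_smul] at e
    exact (coord_unique (by rw [h''.1, ← scalar_mk, h.1]) h''.2 e a).trans (scalar_mk c _).symm

lemma gamma_mk {x : M.obj} {y : Arrow V → M.obj} (hy : IsCoord (k := k) (M.obj.d x) y)
    (a : Arrow V) : gamma a (mk M x) = mk M (y a) :=
  have h := (exists_gamma (mk M x)).choose_spec.choose_spec
  coord_unique h.1 h.2 hy a

/-- The action of a trivial path on the top. -/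
def vertexAct (i : V) : ModTop M →ₗ[k] ModTop M where
  toFun t := vertex k i • t
  map_add' := smul_add _
  map_smul' c t := by
    rw [RingHom.id_apply, scalar_def, scalar_def, smul_smul, smul_smul, Algebra.commutes]

lemma vertexAct_apply (i : V) (t : ModTop M) : vertexAct i t = vertex k i • t := rfl

variable (M) in
/-- The representation of the path algebra of the opposite quiver on the top: a trivial path acts
as the trivial path of `Q` at the same vertex, the reversed arrow `α^*` acts as `gamma α`. -/
def action : PathAlgebra k Vᵒᵖ →ₐ[k] Module.End k (ModTop M) :=
  PathAlgebra.lift (fun i => vertexAct i.unop)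
    (fun i j f => gamma (⟨j.unop, i.unop, f.unop⟩ : Arrow V))
    (fun i => LinearMap.ext fun t => by
      rw [Module.End.mul_apply, vertexAct_apply, vertexAct_apply, smul_smul, vertex_mul_self])
    (fun i j hij => LinearMap.ext fun t => by
      rw [Module.End.mul_apply, vertexAct_apply, vertexAct_apply, smul_smul, vertex_mul_of_ne,
        zero_smul, LinearMap.zero_apply]
      exact fun h => hij (Opposite.unop_injective h))
    (by
      let _ := Fintype.ofFinite V
      let _ := Fintype.ofFinite Vᵒᵖ
      rw [finsum_eq_sum_of_fintype]
      refine LinearMap.ext fun t => ?_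
      rw [LinearMap.sum_apply, Module.End.one_apply]
      conv_rhs => rw [← one_smul (RadSq k V) t, ← sum_vertex, finsum_eq_sum_of_fintype,
        Finset.sum_smul]
      exact Fintype.sum_equiv Opposite.equivToOpposite.symm _ _ fun _ => rfl)
    (fun i j f => LinearMap.ext fun t => by
      obtain ⟨x, y, rfl, hy⟩ := exists_gamma t
      rw [Module.End.mul_apply, gamma_mk hy, vertexAct_apply, ← map_smul]
      exact congrArg (mk M) (hy.1 ⟨j.unop, i.unop, f.unop⟩))

instance : Module (PathAlgebra k Vᵒᵖ) (ModTop M) := Module.compHom (ModTop M) (action M).toRingHom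

lemma smul_def (r : PathAlgebra k Vᵒᵖ) (t : ModTop M) : r • t = action M r t := rfl

lemma vertex_smul (i : V) (t : ModTop M) :
    PathAlgebra.vertex k (Opposite.op i) • t = vertex k i • t := by
  rw [smul_def, action, PathAlgebra.vertex, PathAlgebra.lift_path]
  rfl

lemma arrow_smul {i j : V} (f : i ⟶ j) (t : ModTop M) :
    PathAlgebra.arrow k f.op • t = gamma ⟨i, j, f⟩ t := by
  classical
  rw [smul_def, action, PathAlgebra.arrow, PathAlgebra.lift_path]
  obtain ⟨x, y, rfl, hy⟩ := exists_gamma t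
  change gamma _ (vertex k j • mk M x) = _
  have h := hy.vertex j
  rw [← map_smul] at h
  rw [← map_smul, gamma_mk h, gamma_mk hy, if_pos rfl]
  rfl

variable {N : Reduced.{max u v w, t} (RadSq k V)}

/-- The map induced on the tops by a morphism. -/
def map (f : M ⟶ N) : ModTop M →ₗ[RadSq k V] ModTop N :=
  Submodule.mapQ _ _ (DiffProj.lin f.hom) (Module.le_comap_jacobson _)

lemma map_mk (f : M ⟶ N) (x : M.obj) : map f (mk M x) = mk N (DiffProj.lin f.hom x) := rfl

lemma map_gamma (f : M ⟶ N) (a : Arrow V) (t : ModTop M) :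
    map f (gamma a t) = gamma a (map f t) := by
  obtain ⟨x, y, rfl, hy⟩ := exists_gamma t
  have h := hy.map (DiffProj.lin f.hom)
  rw [DiffProj.lin_comm] at h
  rw [gamma_mk hy, map_mk, map_mk, gamma_mk h]

lemma map_action (f : M ⟶ N) (r : PathAlgebra k Vᵒᵖ) (t : ModTop M) :
    map f (action M r t) = action N r (map f t) := by
  let g : ModTop M →ₗ[k] ModTop N :=
    { toFun := map f
      map_add' := map_add _
      map_smul' := fun c t => map_smul (map f) (algebraMap k (RadSq k V) c) t }
  suffices h : (LinearMap.llcomp k (ModTop M) (ModTop M) (ModTop N) g).comp (action M).toLinearMap =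
      (LinearMap.lcomp k (ModTop N) g).comp (action N).toLinearMap from
    LinearMap.congr_fun (LinearMap.congr_fun h r) t
  refine PathAlgebra.linear_ext fun i j p => LinearMap.ext fun t => ?_
  change map f (action M (PathAlgebra.path p) t) = action N (PathAlgebra.path p) (map f t)
  rw [action, action, PathAlgebra.lift_path, PathAlgebra.lift_path]
  induction p with
  | nil => exact map_smul (map f) _ t
  | cons p q ih =>
    rw [PathAlgebra.pathVal, PathAlgebra.pathVal, Module.End.mul_apply, Module.End.mul_apply,
      map_gamma, ih]

end ModTop

variable (k V) in
/-- The functor `F` from reduced differential projective `kQ/J²`-modules to `kQ^op`-modules, given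
by taking the top. -/
def topFunctor : Reduced.{max u v w, t} (RadSq k V) ⥤ ModuleCat.{t} (PathAlgebra k Vᵒᵖ) where
  obj M := ModuleCat.of _ (ModTop M)
  map f := ModuleCat.ofHom
    { toFun := ModTop.map f
      map_add' := map_add _
      map_smul' := fun r t => ModTop.map_action f r t }
  map_id M := by
    ext t
    obtain ⟨x, rfl⟩ := ModTop.mk_surjective t
    rfl
  map_comp f g := by
    ext t
    obtain ⟨x, rfl⟩ := ModTop.mk_surjective t
    rfl

end Functor

end DifferentialProjective

end

open DifferentialProjective DifferentialProjective.DiffProj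

/-!
Write `Λ = kQ/J²`. The square of the radical of `Λ` is zero, so a map of projective `Λ`-modules with
image in the radical vanishes on the radical (`apply_eq_zero_of_mem`). Together with the lifting
property of projective modules, this lets one pass freely between a projective module and its top
`M / rad M`, which is a module over the semisimple algebra `kV` spanned by the trivial paths.

A differential projective module `(M, d)` is reduced exactly when `d` maps into the radical
(`d_mem_of_reduced`, `isReducedObj_of_d_mem`). For an arbitrary `(M, d)` the induced differential on
the top has a quasi-inverse `h` such that `d h + h d` is idempotent there (`exists_homotopy`). After
lifting `h` to `M`, a polynomial in `d h + h d` is an honest idempotent of `M`; it is null homotopic,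
and the image of the complementary idempotent is a reduced module homotopy equivalent to `M`
(`exists_reduced`).

On reduced modules a null homotopic map has image in the radical, so homotopy equivalent reduced
modules have isomorphic images under `F` (`nonempty_topFunctor_iso`). Conversely, `F` is full: a lift
of a `kQ^op`-linear map of tops to a `Λ`-linear map commutes with the differentials, because `α y`
depends only on the class of `y` in the top (`ModTop.exists_map_eq`). A morphism inducing an
isomorphism of tops is itself an isomorphism, so `F` reflects isomorphism classes
(`nonempty_iso_of_topFunctor_iso`). Finally, a `kQ^op`-module `Y` is the image of its projective
cover over `Λ`, which consists of pairs `(y, (z_α))` with `z_α ∈ e_{s(α)} Y`, with the differential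
`d (y, z) = (0, (α^* y))` (`exists_topFunctor_iso`).

The resulting bijection of isomorphism classes is compatible with direct sums and with zero objects
(`Corresponds.biprod`, `Corresponds.isZero_iff`), hence with indecomposability.
-/

noncomputable section

namespace DifferentialProjective

open DiffProj RadSq

/-! ### Modules annihilated by the arrows -/

section Semisimple

variable {k : Type u} [Field k] {V : Type v} [Quiver.{w} V] [Finite V]
  [∀ i j : V, Finite (i ⟶ j)]

lemma smul_mem_of_aug {M : Type*} [AddCommGroup M] [Module (RadSq k V) M] {r : RadSq k V}
    (hr : ∀ i, aug i r = 0) (x : M) : r • x ∈ Module.jacobson (RadSq k V) M :=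
  Ring.jacobson_smul_top_le _ _
    (Submodule.smul_mem_smul (mem_jacobson_of_aug hr) Submodule.mem_top)

section Annihilated

variable {T : Type*} [AddCommGroup T] [Module (RadSq k V) T]

/-- On a module annihilated by the arrows, an element of the algebra acts on `e_i T` as a scalar. -/
lemma vertex_smul_smul
    (hT : ∀ r : RadSq k V, (∀ i, aug i r = 0) → ∀ t : T, r • t = 0) (r : RadSq k V) (i : V)
    (t : T) : vertex k i • r • t = algebraMap k (RadSq k V) (aug i r) • vertex k i • t := by
  rw [smul_smul, smul_smul, ← sub_eq_zero, ← sub_smul]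
  refine hT _ (fun j => ?_) t
  by_cases h : i = j
  · subst h; simp [aug_algebraMap, aug_vertex_self]
  · simp [aug_vertex_of_ne h]

lemma smul_vertex_smul
    (hT : ∀ r : RadSq k V, (∀ i, aug i r = 0) → ∀ t : T, r • t = 0) (r : RadSq k V) (i : V)
    (t : T) : r • vertex k i • t = algebraMap k (RadSq k V) (aug i r) • vertex k i • t := by
  rw [smul_smul, smul_smul, ← sub_eq_zero, ← sub_smul]
  refine hT _ (fun j => ?_) t
  by_cases h : i = j
  · subst h; simp [aug_algebraMap, aug_vertex_self]
  · simp [aug_vertex_of_ne h]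

lemma sum_vertex_smul [Fintype V] (t : T) : ∑ i : V, vertex k i • t = t := by
  rw [← Finset.sum_smul, ← finsum_eq_sum_of_fintype, sum_vertex, one_smul]

lemma smul_eq_sum [Fintype V]
    (hT : ∀ r : RadSq k V, (∀ i, aug i r = 0) → ∀ t : T, r • t = 0) (r : RadSq k V) (t : T) :
    r • t = ∑ i : V, algebraMap k (RadSq k V) (aug i r) • vertex k i • t := by
  conv_lhs => rw [← sum_vertex_smul (k := k) (V := V) t, Finset.smul_sum]
  exact Finset.sum_congr rfl fun i _ => smul_vertex_smul hT r i t

/-- Endomorphisms of modules annihilated by the arrows are von Neumann regular. The quasi-inverse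
is obtained by averaging a `k`-linear one over the vertices. -/
lemma exists_quasiInverse
    (hT : ∀ r : RadSq k V, (∀ i, aug i r = 0) → ∀ t : T, r • t = 0)
    (D : T →ₗ[RadSq k V] T) : ∃ h : T →ₗ[RadSq k V] T, ∀ t, D (h (D t)) = D t := by
  let _ := Fintype.ofFinite V
  let _ : Module k T := Module.compHom T (algebraMap k (RadSq k V))
  have hk : ∀ (c : k) (t : T), algebraMap k (RadSq k V) c • t = c • t := fun _ _ => rfl
  let D' : T →ₗ[k] T :=
    { toFun := D, map_add' := map_add D, map_smul' := fun c t => map_smul D _ t }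
  obtain ⟨s, hs⟩ := D'.rangeRestrict.exists_rightInverse_of_surjective D'.range_rangeRestrict
  obtain ⟨g, hg⟩ := s.exists_extend
  have hDg : ∀ t, D (g (D t)) = D t := fun t => by
    have h1 : g (D t) = s (D'.rangeRestrict t) := LinearMap.congr_fun hg (D'.rangeRestrict t)
    rw [h1]
    exact congrArg Subtype.val (LinearMap.congr_fun hs (D'.rangeRestrict t))
  refine ⟨{ toFun := fun t => ∑ i : V, vertex k i • g (vertex k i • t),
            map_add' := fun t t' => by simp [smul_add, Finset.sum_add_distrib],
            map_smul' := fun r t => ?_ }, fun t => ?_⟩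
  · rw [RingHom.id_apply, Finset.smul_sum]
    refine Finset.sum_congr rfl fun i _ => ?_
    rw [vertex_smul_smul hT r, smul_vertex_smul hT r, hk, map_smul, ← hk, smul_smul, smul_smul,
      Algebra.commutes]
  · change D (∑ i : V, vertex k i • g (vertex k i • D t)) = D t
    rw [map_sum]
    conv_rhs => rw [← sum_vertex_smul (k := k) (V := V) (D t)]
    refine Finset.sum_congr rfl fun i _ => ?_
    rw [map_smul D, ← map_smul D (vertex k i) t, hDg, map_smul D, smul_smul, vertex_mul_self]

/-- The quasi-inverse of a differential can be chosen such that `D h h D = 0`, and then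
`D h + h D` is idempotent. -/
lemma exists_homotopy
    (hT : ∀ r : RadSq k V, (∀ i, aug i r = 0) → ∀ t : T, r • t = 0)
    (D : T →ₗ[RadSq k V] T) (hD : ∀ t, D (D t) = 0) :
    ∃ h : T →ₗ[RadSq k V] T, (∀ t, D (h (D t)) = D t) ∧ ∀ t, D (h (h (D t))) = 0 := by
  obtain ⟨h, hh⟩ := exists_quasiInverse hT D
  exact ⟨h - D ∘ₗ h ∘ₗ h, fun t => by simp [hh, hD], fun t => by simp [hh, hD]⟩

end Annihilated

lemma top_smul_eq_zero {M : Type*} [AddCommGroup M] [Module (RadSq k V) M] (r : RadSq k V)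
    (hr : ∀ i, aug i r = 0) (t : M ⧸ Module.jacobson (RadSq k V) M) : r • t = 0 := by
  obtain ⟨x, rfl⟩ := Submodule.Quotient.mk_surjective _ t
  rw [← Submodule.Quotient.mk_smul, Submodule.Quotient.mk_eq_zero]
  exact smul_mem_of_aug hr x

/-- A map into the radical vanishes on the radical, since the square of the arrow ideal is zero. -/
lemma apply_eq_zero_of_mem {M N : Type*} [AddCommGroup M] [Module (RadSq k V) M]
    [Module.Projective (RadSq k V) M] [AddCommGroup N] [Module (RadSq k V) N]
    [Module.Projective (RadSq k V) N] (f : M →ₗ[RadSq k V] N)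
    (hf : ∀ x, f x ∈ Module.jacobson (RadSq k V) N) {x : M}
    (hx : x ∈ Module.jacobson (RadSq k V) M) : f x = 0 := by
  obtain ⟨y, hy⟩ := exists_coord (k := k) hx
  let _ := Fintype.ofFinite (Arrow V)
  rw [hy.2, finsum_eq_sum_of_fintype, map_sum]
  exact Finset.sum_eq_zero fun a _ => by rw [map_smul, arrow_smul_eq_zero a (hf _)]

end Semisimple

/-! ### Reduction of differential projective modules -/

section Reduction

/-- If `p² - p` squares to zero, then `3p² - 2p³` is an idempotent. It is written as a multiple of
`p`, so that it is null homotopic when `p` is. -/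
lemma isIdempotentElem_of_sq {R : Type*} [Ring R] {p : R}
    (h : (p * p - p) * (p * p - p) = 0) :
    p * (3 * p - 2 * (p * p)) * (p * (3 * p - 2 * (p * p))) = p * (3 * p - 2 * (p * p)) := by
  have : p * (3 * p - 2 * (p * p)) * (p * (3 * p - 2 * (p * p))) - p * (3 * p - 2 * (p * p)) =
      (p * p - p) * (p * p - p) * (4 * (p * p) - 4 * p - 3) := by noncomm_ring
  rwa [h, zero_mul, sub_eq_zero] at this

variable {k : Type u} [Field k] {V : Type v} [Quiver.{w} V] [Finite V]
  [∀ i j : V, Finite (i ⟶ j)]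

/-- If `1 = r d + d r` and the image of `d` lies in the radical, then the module equals its radical,
and hence it is zero. -/
lemma eq_zero_of_contractible_of_d_mem {N : DiffProj.{max u v w, t} (RadSq k V)}
    (hd : ∀ x, N.d x ∈ Module.jacobson (RadSq k V) N) (hN : Contractible N) (x : N) : x = 0 := by
  obtain ⟨r, hr⟩ := hN
  have hrad : ∀ y : N, y ∈ Module.jacobson (RadSq k V) N := fun y => by
    rw [show y = r (N.d y) + N.d (r y) from LinearMap.congr_fun hr y]
    exact add_mem (Module.le_comap_jacobson r (hd y)) (hd _)
  exact apply_eq_zero_of_mem LinearMap.id hrad (hrad x)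

/-- The converse of `d_mem_of_reduced`. -/
lemma isReducedObj_of_d_mem {M : DiffProj.{max u v w, t} (RadSq k V)}
    (hd : ∀ x, M.d x ∈ Module.jacobson (RadSq k V) M) : IsReducedObj (RadSq k V) M := by
  rintro N N' ⟨e⟩ hN
  let p : M ⟶ N := e.hom ≫ biprod.fst
  let i : N ⟶ M := biprod.inl ≫ e.inv
  have hip : i ≫ p = 𝟙 N := by simp [i, p]
  refine ⟨fun x y => ?_⟩
  have h0 := eq_zero_of_contractible_of_d_mem (N := N) (fun z => by
    have hz : lin p (M.d (lin i z)) = N.d z := by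
      rw [lin_comm]
      exact congrArg N.d (congrArg (fun f : N ⟶ N => lin f z) hip)
    rw [← hz]
    exact Module.le_comap_jacobson (lin p) (hd _)) hN
  rw [h0 x, h0 y]

/-- The image of an idempotent endomorphism `π` is homotopy equivalent to the whole module if the
complementary idempotent `1 - π` is null homotopic. -/
lemma nonempty_iso_image_of_nullHomotopic {M : DiffProj.{max u v w, t} (RadSq k V)}
    (π : M →ₗ[RadSq k V] M) (hπ : ∀ x, π (π x) = π x) (hd : ∀ x, π (M.d x) = M.d (π x))
    (h : NullHomotopic (LinearMap.id - π)) :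
    Nonempty ((toHomotopy (RadSq k V)).obj M ≅ (toHomotopy (RadSq k V)).obj (imageObj π hπ hd)) := by
  let p : M ⟶ imageObj π hπ hd := ⟨π.rangeRestrict, fun x => Subtype.ext (hd x)⟩
  let i : imageObj π hπ hd ⟶ M := ⟨(LinearMap.range π).subtype, fun x => rfl⟩
  have hip : i ≫ p = 𝟙 _ := by
    ext ⟨_, x, rfl⟩
    exact Subtype.ext (hπ x)
  refine ⟨⟨(toHomotopy _).map p, (toHomotopy _).map i, ?_, ?_⟩⟩
  · rw [← Functor.map_comp, ← CategoryTheory.Functor.map_id]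
    refine (CategoryTheory.Quotient.sound _ ?_).symm
    exact h
  · rw [← Functor.map_comp, hip, CategoryTheory.Functor.map_id]

/-- Every differential projective module is homotopy equivalent to a reduced one. If `h` induces
on the top a quasi-inverse of the differential, then `d h + h d` is idempotent modulo the radical;
the corresponding idempotent is null homotopic and its complement is reduced. -/
lemma exists_reduced (M : DiffProj.{max u v w, t} (RadSq k V)) :
    ∃ N : Reduced.{max u v w, t} (RadSq k V),
      Nonempty ((toHomotopy (RadSq k V)).obj M ≅ (toHomotopy (RadSq k V)).obj N.obj) := by
  let J := Module.jacobson (RadSq k V) M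
  let D : (M ⧸ J) →ₗ[RadSq k V] (M ⧸ J) := J.mapQ J M.d (Module.le_comap_jacobson _)
  have hD : ∀ x, J.mkQ (M.d x) = D (J.mkQ x) := fun x => rfl
  have hDD : ∀ t, D (D t) = 0 := fun t => by
    obtain ⟨x, rfl⟩ := J.mkQ_surjective t
    rw [← hD, ← hD, M.d_d, map_zero]
  obtain ⟨h', h1, h2⟩ := exists_homotopy top_smul_eq_zero D hDD
  obtain ⟨h, hh⟩ := Module.projective_lifting_property J.mkQ (h' ∘ₗ J.mkQ) J.mkQ_surjective
  have hh : ∀ x, J.mkQ (h x) = h' (J.mkQ x) := LinearMap.congr_fun hh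
  let p : Module.End (RadSq k V) M := h * M.d + M.d * h
  have hp : ∀ x, p x = h (M.d x) + M.d (h x) := fun x => rfl
  have hpd : ∀ x, p (M.d x) = M.d (p x) := fun x => by simp [hp, M.d_d]
  have hq : ∀ x, J.mkQ (p x) = h' (D (J.mkQ x)) + D (h' (J.mkQ x)) := fun x => by
    rw [hp, map_add, hh, hD, hD, hh]
  have hqq : ∀ x, J.mkQ (p (p x)) = J.mkQ (p x) := fun x => by
    simp [hq, hDD, h1, h2]
  have hn : ∀ x, (p * p - p) x ∈ J := fun x => by
    rw [← Submodule.Quotient.mk_eq_zero]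
    change J.mkQ (p (p x) - p x) = 0
    rw [map_sub, hqq, sub_self]
  have hpp : (p * p - p) * (p * p - p) = 0 :=
    LinearMap.ext fun x => apply_eq_zero_of_mem (p * p - p) hn (hn x)
  obtain ⟨c, hc⟩ : ∃ c : Module.End (RadSq k V) M, c = 3 * p - 2 * (p * p) := ⟨_, rfl⟩
  have hcx : ∀ x, c x = 3 • p x - 2 • p (p x) := fun x => by
    rw [hc]
    change (3 : Module.End (RadSq k V) M) (p x) - (2 : Module.End (RadSq k V) M) (p (p x)) = _
    rw [Module.End.ofNat_apply, Module.End.ofNat_apply]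
  have hcd : ∀ x, c (M.d x) = M.d (c x) := fun x => by simp [hcx, hpd]
  have he : ∀ x, p (c (p (c x))) = p (c x) := fun x =>
    LinearMap.congr_fun (hc ▸ isIdempotentElem_of_sq hpp) x
  -- `p * c` is the idempotent `3p² - 2p³`; it agrees with `p` modulo the radical.
  let e : M →ₗ[RadSq k V] M := LinearMap.id - p * c
  have hex : ∀ x, e x = x - p (c x) := fun x => rfl
  have hee : ∀ x, e (e x) = e x := fun x => by simp [hex, he]
  have hed : ∀ x, e (M.d x) = M.d (e x) := fun x => by simp [hex, hcd, hpd]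
  have hmem : ∀ x, M.d (e x) ∈ J := fun x => by
    rw [← Submodule.Quotient.mk_eq_zero]
    change J.mkQ (M.d (e x)) = 0
    have h3 : J.mkQ (p (c x)) = J.mkQ (p x) := by
      rw [hcx, map_sub, map_nsmul, map_nsmul, map_sub, map_nsmul, map_nsmul, hqq, hqq, hqq]
      abel
    rw [hD, hex, map_sub, h3, hq]
    simp [hDD, h1]
  refine ⟨⟨imageObj e hee hed, isReducedObj_of_d_mem ?_⟩,
    nonempty_iso_image_of_nullHomotopic e hee hed ⟨h * c, LinearMap.ext fun x => ?_⟩⟩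
  · rintro ⟨_, x, rfl⟩
    have h4 : e.rangeRestrict (M.d (e x)) = (imageObj e hee hed).d ⟨e x, x, rfl⟩ :=
      Subtype.ext (by
        change e (M.d (e x)) = M.d (e x)
        rw [hed, hee])
    rw [← h4]
    exact Module.le_comap_jacobson e.rangeRestrict (hmem x)
  · change x - e x = h (c (M.d x)) + M.d (h (c x))
    rw [hex, sub_sub_cancel, hp, hcd]

end Reduction

/-! ### Linearity over a path algebra -/

section PathLinear

variable {k : Type u} [Field k] {W : Type v} [Quiver.{w} W] [Finite W]

/-- Linearity over a path algebra may be checked on scalars, trivial paths and arrows. -/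
lemma map_pathAlgebra_smul {Y Y' : Type*} [AddCommGroup Y] [AddCommGroup Y']
    [Module (PathAlgebra k W) Y] [Module (PathAlgebra k W) Y'] (θ : Y →+ Y')
    (hk : ∀ (c : k) (y : Y), θ (algebraMap k (PathAlgebra k W) c • y) =
      algebraMap k (PathAlgebra k W) c • θ y)
    (hv : ∀ (i : W) (y : Y), θ (PathAlgebra.vertex k i • y) = PathAlgebra.vertex k i • θ y)
    (ha : ∀ (i j : W) (f : i ⟶ j) (y : Y),
      θ (PathAlgebra.arrow k f • y) = PathAlgebra.arrow k f • θ y)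
    (r : PathAlgebra k W) (y : Y) : θ (r • y) = r • θ y := by
  let _ : Module k Y' := Module.compHom Y' (algebraMap k (PathAlgebra k W))
  let F : PathAlgebra k W →ₗ[k] Y' :=
    { toFun := fun r => θ (r • y)
      map_add' := fun r r' => by rw [add_smul, map_add]
      map_smul' := fun c r => by
        rw [Algebra.smul_def, mul_smul, hk]
        rfl }
  let G : PathAlgebra k W →ₗ[k] Y' :=
    { toFun := fun r => r • θ y
      map_add' := fun r r' => add_smul _ _ _
      map_smul' := fun c r => by
        rw [Algebra.smul_def, mul_smul]
        rfl }
  suffices h : F = G from LinearMap.congr_fun h r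
  refine PathAlgebra.linear_ext fun i j p => ?_
  change θ ((PathAlgebra.path p : PathAlgebra k W) • y) = (PathAlgebra.path p : PathAlgebra k W) • θ y
  induction p with
  | nil => exact hv i y
  | cons p f ih => rw [PathAlgebra.path_cons, mul_smul, mul_smul, ha, ih]

end PathLinear

/-! ### Morphisms of reduced modules and maps of tops -/

section TopFunctor

variable {k : Type u} [Field k] {V : Type v} [Quiver.{w} V] [Finite V]
  [∀ i j : V, Finite (i ⟶ j)]

namespace ModTop

variable {M N : Reduced.{max u v w, t} (RadSq k V)}

lemma algebraMap_smul (c : k) (t : ModTop M) :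
    algebraMap k (PathAlgebra k Vᵒᵖ) c • t = algebraMap k (RadSq k V) c • t := by
  rw [smul_def, AlgHom.commutes]
  rfl

lemma smul_eq_zero (r : RadSq k V) (hr : ∀ i, aug i r = 0) (t : ModTop M) : r • t = 0 :=
  top_smul_eq_zero r hr t

/-- A map of tops which is linear over the path algebra of the opposite quiver is linear over
`kQ/J²`, since the arrows of `Q` annihilate the tops. -/
lemma map_radSq_smul (φ : ModTop M →ₗ[PathAlgebra k Vᵒᵖ] ModTop N) (r : RadSq k V)
    (t : ModTop M) : φ (r • t) = r • φ t := by
  let _ := Fintype.ofFinite V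
  rw [smul_eq_sum smul_eq_zero r t, smul_eq_sum smul_eq_zero r (φ t), map_sum]
  refine Finset.sum_congr rfl fun i _ => ?_
  rw [← algebraMap_smul, ← vertex_smul, map_smul, map_smul, vertex_smul, algebraMap_smul]

lemma arrow_smul_congr (a : Arrow V) {x y : N.obj} (h : mk N x = mk N y) :
    RadSq.arrow k a • x = RadSq.arrow k a • y := by
  rw [← sub_eq_zero, ← smul_sub]
  refine arrow_smul_eq_zero a ?_
  rw [← mk_eq_zero, map_sub, h, sub_self]

/-- Every map between the tops which is linear over the path algebra of the opposite quiver is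
induced by a morphism of differential modules: a lift to a module map commutes with the
differentials since `α y` depends only on the class of `y` in the top. -/
lemma exists_map_eq (φ : ModTop M →ₗ[PathAlgebra k Vᵒᵖ] ModTop N) :
    ∃ f : M ⟶ N, ∀ t, map f t = φ t := by
  let φ' : ModTop M →ₗ[RadSq k V] ModTop N :=
    { toFun := φ, map_add' := map_add φ, map_smul' := map_radSq_smul φ }
  obtain ⟨f, hf⟩ := Module.projective_lifting_property (mk N) (φ' ∘ₗ mk M) mk_surjective
  have hf : ∀ x, mk N (f x) = φ (mk M x) := LinearMap.congr_fun hf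
  have hd : ∀ x, f (M.obj.d x) = N.obj.d (f x) := fun x => by
    obtain ⟨y, hy⟩ := exists_coord (k := k) (d_mem_of_reduced M.property x)
    obtain ⟨z, hz⟩ := exists_coord (k := k) (d_mem_of_reduced N.property (f x))
    rw [(hy.map f).2, hz.2]
    refine finsum_congr fun a => arrow_smul_congr a ?_
    rw [hf, ← gamma_mk hy, ← gamma_mk hz, hf, ← arrow_smul, ← arrow_smul, map_smul]
  refine ⟨ObjectProperty.homMk ⟨f, hd⟩, fun t => ?_⟩
  obtain ⟨x, rfl⟩ := mk_surjective t
  exact hf x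

/-- A null homotopic map between reduced objects induces zero on the tops. -/
lemma map_eq_of_homotopyRel {f g : M ⟶ N} (h : homotopyRel (RadSq k V) f.hom g.hom)
    (t : ModTop M) : map f t = map g t := by
  obtain ⟨x, rfl⟩ := mk_surjective t
  obtain ⟨r, hr⟩ := h
  rw [map_mk, map_mk, ← sub_eq_zero, ← map_sub, mk_eq_zero]
  rw [show lin f.hom x - lin g.hom x = r (M.obj.d x) + N.obj.d (r x) from LinearMap.congr_fun hr x]
  exact add_mem (Module.le_comap_jacobson r (d_mem_of_reduced M.property x))
    (d_mem_of_reduced N.property _)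

end ModTop

variable {M N : Reduced.{max u v w, t} (RadSq k V)}

lemma topFunctor_map_eq {f g : M ⟶ N} (h : homotopyRel (RadSq k V) f.hom g.hom) :
    (topFunctor k V).map f = (topFunctor k V).map g := by
  ext t
  exact ModTop.map_eq_of_homotopyRel h t

/-- Homotopy equivalent reduced objects have isomorphic images under `F`. -/
lemma nonempty_topFunctor_iso
    (e : (toHomotopy (RadSq k V)).obj M.obj ≅ (toHomotopy (RadSq k V)).obj N.obj) :
    Nonempty ((topFunctor k V).obj M ≅ (topFunctor k V).obj N) := by
  obtain ⟨f, hf⟩ := (toHomotopy (RadSq k V)).map_surjective e.hom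
  obtain ⟨g, hg⟩ := (toHomotopy (RadSq k V)).map_surjective e.inv
  let f' : M ⟶ N := ObjectProperty.homMk f
  let g' : N ⟶ M := ObjectProperty.homMk g
  refine ⟨⟨(topFunctor k V).map f', (topFunctor k V).map g', ?_, ?_⟩⟩
  · rw [← CategoryTheory.Functor.map_comp, ← CategoryTheory.Functor.map_id]
    refine topFunctor_map_eq ((CategoryTheory.Quotient.functor_map_eq_iff _ (f ≫ g) (𝟙 _)).1 ?_)
    rw [CategoryTheory.Functor.map_comp, hf, hg, e.hom_inv_id, CategoryTheory.Functor.map_id]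
  · rw [← CategoryTheory.Functor.map_comp, ← CategoryTheory.Functor.map_id]
    refine topFunctor_map_eq ((CategoryTheory.Quotient.functor_map_eq_iff _ (g ≫ f) (𝟙 _)).1 ?_)
    rw [CategoryTheory.Functor.map_comp, hf, hg, e.inv_hom_id, CategoryTheory.Functor.map_id]

/-- An endomorphism of a projective module which is the identity modulo the radical is
invertible. -/
lemma bijective_of_sub_mem {P : Type*} [AddCommGroup P] [Module (RadSq k V) P]
    [Module.Projective (RadSq k V) P] (f : P →ₗ[RadSq k V] P)
    (hf : ∀ x, f x - x ∈ Module.jacobson (RadSq k V) P) : Function.Bijective f := by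
  have h : ∀ x, f (f x - x) = f x - x := fun x =>
    sub_eq_zero.1 (apply_eq_zero_of_mem (f - LinearMap.id) hf (hf x))
  refine ⟨(injective_iff_map_eq_zero f).2 fun x hx => ?_, fun y => ⟨y - (f y - y), ?_⟩⟩
  · have h' := h x
    rw [hx, zero_sub, map_neg, hx, neg_zero] at h'
    exact (neg_eq_zero.1 h'.symm)
  · rw [map_sub, h, sub_sub_cancel]

/-- Reduced objects with isomorphic images under `F` are isomorphic. -/
lemma nonempty_iso_of_topFunctor_iso (e : (topFunctor k V).obj M ≅ (topFunctor k V).obj N) :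
    Nonempty (M.obj ≅ N.obj) := by
  obtain ⟨f, hf⟩ := ModTop.exists_map_eq e.hom.hom
  obtain ⟨g, hg⟩ := ModTop.exists_map_eq e.inv.hom
  have hgf : Function.Bijective (lin g.hom ∘ₗ lin f.hom) := bijective_of_sub_mem _ fun x => by
    rw [← ModTop.mk_eq_zero, map_sub, sub_eq_zero]
    change ModTop.map g (ModTop.map f (ModTop.mk M x)) = _
    rw [hf, hg]
    exact LinearMap.congr_fun (congrArg ModuleCat.Hom.hom e.hom_inv_id) (ModTop.mk M x)
  have hfg : Function.Bijective (lin f.hom ∘ₗ lin g.hom) := bijective_of_sub_mem _ fun x => by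
    rw [← ModTop.mk_eq_zero, map_sub, sub_eq_zero]
    change ModTop.map f (ModTop.map g (ModTop.mk N x)) = _
    rw [hf, hg]
    exact LinearMap.congr_fun (congrArg ModuleCat.Hom.hom e.inv_hom_id) (ModTop.mk N x)
  have hb : Function.Bijective (lin f.hom) :=
    ⟨Function.Injective.of_comp (f := lin g.hom) hgf.1,
      Function.Surjective.of_comp (g := lin g.hom) hfg.2⟩
  let E := LinearEquiv.ofBijective (lin f.hom) hb
  have hE : ∀ x, E (E.symm x) = x := E.apply_symm_apply
  refine ⟨⟨f.hom, ⟨E.symm.toLinearMap, fun x => ?_⟩, ?_, ?_⟩⟩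
  · apply E.injective
    change E (E.symm (N.obj.d x)) = lin f.hom (M.obj.d (E.symm x))
    rw [hE, lin_comm]
    exact congrArg N.obj.d (hE x).symm
  · ext x
    exact E.symm_apply_apply x
  · ext x
    exact hE x

/-! ### Direct sums -/

/-- The direct sum of two reduced objects. -/
def reducedSum (M N : Reduced.{max u v w, t} (RadSq k V)) :
    Reduced.{max u v w, t} (RadSq k V) where
  obj := directSum M.obj N.obj
  property := isReducedObj_of_d_mem fun x => by
    have h : (directSum M.obj N.obj).d x = LinearMap.inl (RadSq k V) M.obj N.obj (M.obj.d x.1) +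
        LinearMap.inr (RadSq k V) M.obj N.obj (N.obj.d x.2) :=
      Prod.ext (add_zero _).symm (zero_add _).symm
    rw [h]
    exact add_mem (Module.le_comap_jacobson _ (d_mem_of_reduced M.property _))
      (Module.le_comap_jacobson _ (d_mem_of_reduced N.property _))

lemma nonempty_toHomotopy_sum_iso (M N : Reduced.{max u v w, t} (RadSq k V)) :
    Nonempty ((toHomotopy (RadSq k V)).obj (reducedSum M N).obj ≅
      (toHomotopy (RadSq k V)).obj M.obj ⊞ (toHomotopy (RadSq k V)).obj N.obj) :=
  have := preservesBinaryBiproduct_of_preservesBiproduct (toHomotopy (RadSq k V)) M.obj N.obj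
  ⟨biprod.uniqueUpToIso _ _
    (isBinaryBilimitOfPreserves (toHomotopy (RadSq k V)) (biconeIsBilimit M.obj N.obj))⟩

lemma nonempty_topFunctor_sum_iso (M N : Reduced.{max u v w, t} (RadSq k V)) :
    Nonempty ((topFunctor k V).obj (reducedSum M N) ≅
      (topFunctor k V).obj M ⊞ (topFunctor k V).obj N) := by
  let i₁ : M ⟶ reducedSum M N := ObjectProperty.homMk (bicone M.obj N.obj).inl
  let i₂ : N ⟶ reducedSum M N := ObjectProperty.homMk (bicone M.obj N.obj).inr
  let p₁ : reducedSum M N ⟶ M := ObjectProperty.homMk (bicone M.obj N.obj).fst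
  let p₂ : reducedSum M N ⟶ N := ObjectProperty.homMk (bicone M.obj N.obj).snd
  let F := topFunctor.{u, v, w, t} k V
  let b : BinaryBicone (F.obj M) (F.obj N) :=
    { pt := F.obj (reducedSum M N)
      fst := F.map p₁
      snd := F.map p₂
      inl := F.map i₁
      inr := F.map i₂
      inl_fst := by
        rw [← CategoryTheory.Functor.map_comp, ← CategoryTheory.Functor.map_id]
        rfl
      inl_snd := by
        ext t
        obtain ⟨x, rfl⟩ := ModTop.mk_surjective t
        exact map_zero (ModTop.mk N)
      inr_fst := by
        ext t
        obtain ⟨x, rfl⟩ := ModTop.mk_surjective t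
        exact map_zero (ModTop.mk M)
      inr_snd := by
        rw [← CategoryTheory.Functor.map_comp, ← CategoryTheory.Functor.map_id]
        rfl }
  have hb : b.IsBilimit := isBinaryBilimitOfTotal b (by
    ext t
    obtain ⟨x, rfl⟩ := ModTop.mk_surjective t
    refine (map_add (ModTop.mk (reducedSum M N)) _ _).symm.trans ?_
    exact congrArg (ModTop.mk (reducedSum M N)) (Prod.ext (add_zero _) (zero_add _)))
  exact ⟨biprod.uniqueUpToIso _ _ hb⟩

end TopFunctor

/-! ### The reduced differential module of a representation of the opposite quiver -/

namespace RadSq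

variable {k : Type u} [Field k] {V : Type v} [Quiver.{w} V] [Finite V]

lemma aug_smul (i : V) (c : k) (r : RadSq k V) : aug i (c • r) = c * aug i r := by
  rw [Algebra.smul_def, map_mul, aug_algebraMap]

lemma coeff_smul (a : Arrow V) (c : k) (r : RadSq k V) : coeff a (c • r) = c * coeff a r := by
  obtain ⟨x, rfl⟩ := exists_mk r
  exact map_smul (PathAlgebra.coeff a.2.2) c x

lemma coeff_one (a : Arrow V) : coeff a (1 : RadSq k V) = 0 := by
  have h := coeff_mul (k := k) a 1 1
  rwa [mul_one, map_one (aug a.2.1), map_one (aug a.1), one_mul, mul_one, left_eq_add] at h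

lemma coeff_vertex (a : Arrow V) (i : V) : coeff a (vertex k i) = 0 :=
  PathAlgebra.coeff_of_length_ne a.2.2 Quiver.Path.nil (by simp)

lemma arrow_mul_vertex_of_ne {i : V} {a : Arrow V} (h : a.1 ≠ i) :
    arrow k a * vertex k i = 0 := by
  rw [← arrow_mul_vertex, mul_assoc, vertex_mul_of_ne h, mul_zero]

variable [∀ i j : V, Finite (i ⟶ j)]

lemma eq_sum_smul [Fintype V] [Fintype (Arrow V)] (r : RadSq k V) :
    r = ∑ i : V, aug i r • vertex k i + ∑ a : Arrow V, coeff a r • arrow k a := by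
  conv_lhs => rw [eq_sum r, finsum_eq_sum_of_fintype, finsum_eq_sum_of_fintype]
  simp only [Algebra.smul_def]

lemma mul_arrow (r : RadSq k V) (a : Arrow V) : r * arrow k a = aug a.2.1 r • arrow k a := by
  let _ := Fintype.ofFinite V
  let _ := Fintype.ofFinite (Arrow V)
  conv_lhs => rw [eq_sum_smul r]
  rw [add_mul, Finset.sum_mul, Finset.sum_mul, Finset.sum_eq_single a.2.1, Finset.sum_eq_zero,
    add_zero, smul_mul_assoc, vertex_mul_arrow]
  · intro b _
    rw [smul_mul_assoc, arrow_mul_arrow, smul_zero]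
  · intro i _ hi
    rw [smul_mul_assoc, vertex_mul_arrow_of_ne (Ne.symm hi), smul_zero]
  · simp

open Classical in
lemma mul_vertex [Fintype (Arrow V)] (r : RadSq k V) (i : V) :
    r * vertex k i =
      aug i r • vertex k i + ∑ a : Arrow V, if a.1 = i then coeff a r • arrow k a else 0 := by
  let _ := Fintype.ofFinite V
  conv_lhs => rw [eq_sum_smul r]
  rw [add_mul, Finset.sum_mul, Finset.sum_mul, Finset.sum_eq_single i, smul_mul_assoc,
    vertex_mul_self]
  · congr 1
    refine Finset.sum_congr rfl fun a _ => ?_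
    split_ifs with h
    · rw [smul_mul_assoc, ← h, arrow_mul_vertex]
    · rw [smul_mul_assoc, arrow_mul_vertex_of_ne h, smul_zero]
  · intro j _ hj
    rw [smul_mul_assoc, vertex_mul_of_ne hj, smul_zero]
  · simp

end RadSq

section Opposite

variable (k : Type u) [Field k] {V : Type v} [Quiver.{w} V] [Finite V]

/-- The trivial path of the opposite quiver at a vertex. -/
abbrev opVertex (i : V) : PathAlgebra k Vᵒᵖ := PathAlgebra.vertex k (Opposite.op i)

/-- The reversed arrow `α^*`. -/
abbrev opArrow (a : Arrow V) : PathAlgebra k Vᵒᵖ := PathAlgebra.arrow k a.2.2.op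

lemma opVertex_mul_self (i : V) : opVertex k i * opVertex k i = opVertex k i := by
  rw [opVertex, PathAlgebra.vertex, PathAlgebra.path_mul_path, Quiver.Path.nil_comp]

lemma opVertex_mul_of_ne {i j : V} (h : i ≠ j) : opVertex k i * opVertex k j = 0 :=
  PathAlgebra.path_mul_path_of_ne _ _ fun h' => h (Opposite.op_injective h').symm

lemma sum_opVertex [Fintype V] : ∑ i : V, opVertex k i = 1 := by
  let _ := Fintype.ofFinite Vᵒᵖ
  rw [PathAlgebra.one_def, finsum_eq_sum_of_fintype]
  exact Fintype.sum_equiv Opposite.equivToOpposite _ _ fun _ => rfl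

lemma opVertex_mul_opArrow (a : Arrow V) : opVertex k a.1 * opArrow k a = opArrow k a :=
  PathAlgebra.path_mul_path Quiver.Path.nil _

lemma opArrow_mul_opVertex (a : Arrow V) : opArrow k a * opVertex k a.2.1 = opArrow k a :=
  (PathAlgebra.path_mul_path _ Quiver.Path.nil).trans (by rw [Quiver.Path.nil_comp]; rfl)

end Opposite

section Hull

variable {k : Type u} [Field k] {V : Type v} [Quiver.{w} V] [Finite V]
  [∀ i j : V, Finite (i ⟶ j)]

variable (V) in
/-- An enumeration of the arrows. It keeps the underlying type of `PairModule` in the universe of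
the given representation. -/
def arrowEquiv : Arrow V ≃ Fin (Nat.card (Arrow V)) := Finite.equivFin _

/-- Pairs of an element `y` of a representation and a family `(z_α)` of elements indexed by the
arrows of `Q`. The algebra `kQ/J²` acts by
`r (y, z) = (∑_i aug_i(r) e_i y, (aug_{t(α)}(r) z_α + coeff_α(r) e_{s(α)} y)_α)`. The field does
not enter the underlying type; it is a parameter because it determines the algebra. -/
def PairModule (_k : Type u) (V : Type v) [Quiver.{w} V] (Y : Type t) : Type t :=
  Y × (Fin (Nat.card (Arrow V)) → Y)

variable {Y : Type t} [AddCommGroup Y] [Module (PathAlgebra k Vᵒᵖ) Y] [Module k Y]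
  [IsScalarTower k (PathAlgebra k Vᵒᵖ) Y]

lemma eq_of_opVertex_smul {y y' : Y} (h : ∀ i : V, opVertex k i • y = opVertex k i • y') :
    y = y' := by
  let _ := Fintype.ofFinite V
  rw [← one_smul (PathAlgebra k Vᵒᵖ) y, ← one_smul (PathAlgebra k Vᵒᵖ) y', ← sum_opVertex,
    Finset.sum_smul, Finset.sum_smul]
  exact Finset.sum_congr rfl fun i _ => h i

/-- The action of `kQ/J²` on a representation of the opposite quiver through the trivial paths. -/
def vertexSmul (r : RadSq k V) (y : Y) : Y := ∑ᶠ i : V, aug i r • opVertex k i • y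

lemma opVertex_smul_vertexSmul (j : V) (r : RadSq k V) (y : Y) :
    opVertex k j • vertexSmul r y = aug j r • opVertex k j • y := by
  let _ := Fintype.ofFinite V
  rw [vertexSmul, finsum_eq_sum_of_fintype, Finset.smul_sum, Finset.sum_eq_single j]
  · rw [smul_comm, smul_smul, opVertex_mul_self]
  · intro i _ hi
    rw [smul_comm, smul_smul, opVertex_mul_of_ne k (Ne.symm hi), zero_smul, smul_zero]
  · simp

lemma opArrow_smul_vertexSmul (a : Arrow V) (r : RadSq k V) (y : Y) :
    opArrow k a • vertexSmul r y = aug a.2.1 r • opArrow k a • y := by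
  rw [← opArrow_mul_opVertex, mul_smul, opVertex_smul_vertexSmul, mul_smul, smul_comm]

namespace PairModule

instance : AddCommGroup (PairModule k V Y) :=
  inferInstanceAs (AddCommGroup (Y × (Fin (Nat.card (Arrow V)) → Y)))

instance : Module k (PairModule k V Y) :=
  inferInstanceAs (Module k (Y × (Fin (Nat.card (Arrow V)) → Y)))

/-- The component of a pair at an arrow. -/
def comp (p : PairModule k V Y) (a : Arrow V) : Y := p.2 (arrowEquiv V a)

/-- The pair with given components. -/
def mk (y : Y) (z : Arrow V → Y) : PairModule k V Y := ⟨y, fun m => z ((arrowEquiv V).symm m)⟩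

@[simp] lemma mk_fst (y : Y) (z : Arrow V → Y) : (mk y z : PairModule k V Y).1 = y := rfl

@[simp] lemma mk_comp (y : Y) (z : Arrow V → Y) (a : Arrow V) :
    comp (mk y z : PairModule k V Y) a = z a := congrArg z ((arrowEquiv V).symm_apply_apply a)

@[simp] lemma add_fst (p q : PairModule k V Y) : (p + q).1 = p.1 + q.1 := rfl

@[simp] lemma add_comp (p q : PairModule k V Y) (a : Arrow V) :
    comp (p + q) a = comp p a + comp q a := rfl

@[simp] lemma zero_fst : (0 : PairModule k V Y).1 = 0 := rfl

@[simp] lemma zero_comp (a : Arrow V) : comp (0 : PairModule k V Y) a = 0 := rfl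

@[simp] lemma scalar_fst (c : k) (p : PairModule k V Y) : (c • p).1 = c • p.1 := rfl

@[simp] lemma scalar_comp (c : k) (p : PairModule k V Y) (a : Arrow V) :
    comp (c • p) a = c • comp p a := rfl

@[ext] lemma ext {p q : PairModule k V Y} (h : p.1 = q.1) (h' : ∀ a, comp p a = comp q a) :
    p = q := by
  refine Prod.ext h (funext fun m => ?_)
  obtain ⟨a, rfl⟩ := (arrowEquiv V).surjective m
  exact h' a

instance : SMul (RadSq k V) (PairModule k V Y) where
  smul r p := mk (vertexSmul r p.1)
    fun a => aug a.2.1 r • comp p a + coeff a r • opVertex k a.1 • p.1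

lemma smul_fst (r : RadSq k V) (p : PairModule k V Y) : (r • p).1 = vertexSmul r p.1 := rfl

@[simp] lemma smul_comp (r : RadSq k V) (p : PairModule k V Y) (a : Arrow V) :
    comp (r • p) a = aug a.2.1 r • comp p a + coeff a r • opVertex k a.1 • p.1 := mk_comp _ _ _

@[simp] lemma opVertex_smul_fst (i : V) (r : RadSq k V) (p : PairModule k V Y) :
    opVertex k i • (r • p).1 = aug i r • opVertex k i • p.1 := opVertex_smul_vertexSmul i r p.1

lemma ext_vertex {p q : PairModule k V Y} (h : ∀ i : V, opVertex k i • p.1 = opVertex k i • q.1)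
    (h' : ∀ a, comp p a = comp q a) : p = q := ext (eq_of_opVertex_smul h) h'

instance : Module (RadSq k V) (PairModule k V Y) where
  one_smul p := ext_vertex (fun i => by simp) (fun a => by simp [coeff_one])
  mul_smul r s p := ext_vertex (fun i => by simp [mul_smul]) (fun a => by
    simp only [smul_comp, map_mul, coeff_mul, opVertex_smul_fst, smul_add, add_smul, mul_smul]
    abel)
  smul_zero r := ext_vertex (fun i => by simp) (fun a => by simp)
  smul_add r p q := ext_vertex (fun i => by simp) (fun a => by
    simp only [smul_comp, add_comp, add_fst, smul_add]
    abel)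
  add_smul r s p := ext_vertex (fun i => by simp [add_smul]) (fun a => by
    simp only [smul_comp, add_comp, map_add, add_smul]
    abel)
  zero_smul p := ext_vertex (fun i => by simp) (fun a => by simp)

instance : IsScalarTower k (RadSq k V) (PairModule k V Y) where
  smul_assoc c r p := ext_vertex
    (fun i => by rw [opVertex_smul_fst, scalar_fst, smul_comm (opVertex k i) c,
      opVertex_smul_fst, aug_smul, mul_smul])
    (fun a => by simp [aug_smul, coeff_smul, mul_smul])

end PairModule

variable (k V Y) in
/-- The submodule of the pairs `(y, z)` with `z_α ∈ e_{s(α)} Y`. As a module over `kQ/J²` it is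
the direct sum of the modules `(kQ/J²) e_i ⊗ e_i Y`, the projective cover of `Y`. -/
def hull : Submodule (RadSq k V) (PairModule k V Y) where
  carrier := {p | ∀ a : Arrow V, opVertex k a.1 • p.comp a = p.comp a}
  zero_mem' := fun a => by simp
  add_mem' := fun {p q} hp hq a => by rw [PairModule.add_comp, smul_add, hp, hq]
  smul_mem' := fun r p hp a => by
    rw [PairModule.smul_comp, smul_add, smul_comm, hp, smul_comm, smul_smul, opVertex_mul_self]

namespace hull

/-- The element `(y, 0)`. -/
def incl : Y →ₗ[k] hull k V Y where
  toFun y := ⟨PairModule.mk y fun _ => 0, fun a => by simp⟩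
  map_add' y y' := Subtype.ext (PairModule.ext rfl fun a => by simp)
  map_smul' c y := Subtype.ext (PairModule.ext rfl fun a => by simp)

@[simp] lemma incl_fst (y : Y) : (incl y : hull k V Y).1.1 = y := rfl

@[simp] lemma incl_comp (y : Y) (a : Arrow V) : (incl y : hull k V Y).1.comp a = 0 :=
  PairModule.mk_comp y (fun _ => 0) a

lemma ext_vertex {p q : hull k V Y} (h : ∀ i : V, opVertex k i • p.1.1 = opVertex k i • q.1.1)
    (h' : ∀ a, p.1.comp a = q.1.comp a) : p = q := Subtype.ext (PairModule.ext_vertex h h')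

lemma vertex_smul_incl (i : V) (y : Y) :
    vertex k i • (incl y : hull k V Y) = incl (opVertex k i • y) := by
  refine ext_vertex (fun j => ?_) fun a => ?_
  · rw [Submodule.coe_smul, PairModule.opVertex_smul_fst, incl_fst, incl_fst]
    by_cases h : i = j
    · subst h; rw [aug_vertex_self, one_smul, smul_smul, opVertex_mul_self]
    · rw [aug_vertex_of_ne h, zero_smul, smul_smul, opVertex_mul_of_ne k (Ne.symm h), zero_smul]
  · rw [Submodule.coe_smul, PairModule.smul_comp, incl_comp, incl_comp, coeff_vertex, smul_zero,
      zero_smul, add_zero]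

lemma arrow_smul_fst (a : Arrow V) (p : hull k V Y) : (RadSq.arrow k a • p).1.1 = 0 :=
  eq_of_opVertex_smul fun i => by
    rw [Submodule.coe_smul, PairModule.opVertex_smul_fst, aug_arrow, zero_smul, smul_zero]

lemma coe_sum {ι : Type*} (s : Finset ι) (f : ι → hull k V Y) :
    (∑ i ∈ s, f i).1.1 = ∑ i ∈ s, (f i).1.1 :=
  map_sum ((AddMonoidHom.fst Y _).comp (hull k V Y).subtype.toAddMonoidHom) f s

lemma comp_sum {ι : Type*} (s : Finset ι) (f : ι → hull k V Y) (a : Arrow V) :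
    (∑ i ∈ s, f i).1.comp a = ∑ i ∈ s, (f i).1.comp a :=
  map_sum (((Pi.evalAddMonoidHom _ (arrowEquiv V a)).comp (AddMonoidHom.snd Y _)).comp
    (hull k V Y).subtype.toAddMonoidHom) f s

/-- Every element is `(y, 0) + ∑_α α (z_α, 0)`. -/
lemma eq_incl_add [Fintype (Arrow V)] (p : hull k V Y) :
    p = incl p.1.1 + ∑ a : Arrow V, RadSq.arrow k a • (incl (p.1.comp a) : hull k V Y) := by
  refine Subtype.ext (PairModule.ext ?_ fun b => ?_)
  · rw [Submodule.coe_add, PairModule.add_fst, coe_sum, Finset.sum_eq_zero, add_zero, incl_fst]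
    exact fun a _ => arrow_smul_fst a _
  · rw [Submodule.coe_add, PairModule.add_comp, incl_comp, zero_add, comp_sum,
      Finset.sum_eq_single b]
    · rw [Submodule.coe_smul, PairModule.smul_comp, incl_comp, smul_zero, zero_add,
        coeff_arrow_self, one_smul, incl_fst, p.2 b]
    · intro a _ hab
      rw [Submodule.coe_smul, PairModule.smul_comp, incl_comp, smul_zero, zero_add,
        coeff_arrow_of_ne hab, zero_smul]
    · simp

/-- A `k`-linear lift `τ` of the inclusion of `Y` along a surjection `f` gives the section
`(y, z) ↦ ∑_i e_i τ(e_i y) + ∑_α α τ(z_α)` of `f`. -/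
instance : Module.Projective (RadSq k V) (hull k V Y) :=
  .of_lifting_property'' fun f hf => by
    classical
    let _ := Fintype.ofFinite V
    let _ := Fintype.ofFinite (Arrow V)
    obtain ⟨g, hg⟩ := (f.restrictScalars k).exists_rightInverse_of_surjective
      (LinearMap.range_eq_top.2 hf)
    obtain ⟨τ, hτ⟩ : ∃ τ : Y →ₗ[k] (hull k V Y →₀ RadSq k V), ∀ y, f (τ y) = incl y :=
      ⟨g ∘ₗ incl, fun y => LinearMap.congr_fun hg (incl y)⟩
    refine ⟨{ toFun := fun p => ∑ i : V, vertex k i • τ (opVertex k i • p.1.1) +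
                ∑ a : Arrow V, RadSq.arrow k a • τ (p.1.comp a)
              map_add' := fun p q => ?_
              map_smul' := fun r p => ?_ }, LinearMap.ext fun p => ?_⟩
    · simp only [Submodule.coe_add, PairModule.add_fst, PairModule.add_comp, smul_add, map_add,
        Finset.sum_add_distrib]
      abel
    · have h1 : ∀ i : V, r • vertex k i • τ (opVertex k i • p.1.1) =
          aug i r • vertex k i • τ (opVertex k i • p.1.1) + ∑ a : Arrow V,
            if a.1 = i then coeff a r • RadSq.arrow k a • τ (opVertex k i • p.1.1) else 0 := by
        intro i
        rw [smul_smul, mul_vertex, add_smul, smul_assoc, Finset.sum_smul]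
        congr 1
        refine Finset.sum_congr rfl fun a _ => ?_
        rw [ite_smul, smul_assoc, zero_smul]
      have h2 : ∀ a : Arrow V, r • RadSq.arrow k a • τ (p.1.comp a) =
          aug a.2.1 r • RadSq.arrow k a • τ (p.1.comp a) := by
        intro a
        rw [smul_smul, mul_arrow, smul_assoc]
      rw [RingHom.id_apply, smul_add, Finset.smul_sum, Finset.smul_sum,
        Finset.sum_congr rfl fun i _ => h1 i, Finset.sum_congr rfl fun a _ => h2 a,
        Finset.sum_add_distrib, Finset.sum_comm]
      simp only [Submodule.coe_smul, PairModule.opVertex_smul_fst, PairModule.smul_comp, map_add,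
        map_smul, smul_add, Finset.sum_add_distrib, Finset.sum_ite_eq, Finset.mem_univ, if_true,
        smul_comm (_ : RadSq k V) (_ : k)]
      abel
    · change f (∑ i : V, vertex k i • τ (opVertex k i • p.1.1) +
                ∑ a : Arrow V, RadSq.arrow k a • τ (p.1.comp a)) = p
      conv_rhs => rw [eq_incl_add p]
      rw [map_add, map_sum, map_sum]
      congr 1
      · rw [← one_smul (PathAlgebra k Vᵒᵖ) p.1.1, ← sum_opVertex, Finset.sum_smul, map_sum]
        refine Finset.sum_congr rfl fun i _ => ?_
        rw [← Finset.sum_smul, sum_opVertex, one_smul, map_smul, hτ, vertex_smul_incl, smul_smul,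
          opVertex_mul_self]
      · exact Finset.sum_congr rfl fun a _ => by rw [map_smul, hτ]

variable (k V Y) in
/-- The differential `d (y, z) = (0, (α^* y)_α)`. -/
def differential : hull k V Y →ₗ[RadSq k V] hull k V Y where
  toFun p := ⟨PairModule.mk 0 fun a => opArrow k a • p.1.1, fun a => by
    rw [PairModule.mk_comp, smul_smul, opVertex_mul_opArrow]⟩
  map_add' p q := Subtype.ext (PairModule.ext (add_zero _).symm fun a => by simp)
  map_smul' r p := ext_vertex (fun i => by simp) fun a => by
    simp [PairModule.smul_fst, opArrow_smul_vertexSmul]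

@[simp] lemma differential_fst (p : hull k V Y) : (differential k V Y p).1.1 = 0 := rfl

@[simp] lemma differential_comp (p : hull k V Y) (a : Arrow V) :
    (differential k V Y p).1.comp a = opArrow k a • p.1.1 :=
  PairModule.mk_comp 0 (fun a => opArrow k a • p.1.1) a

lemma sum_arrow_smul_mem [Fintype (Arrow V)] (y : Arrow V → hull k V Y) :
    ∑ a : Arrow V, RadSq.arrow k a • y a ∈ Module.jacobson (RadSq k V) (hull k V Y) :=
  sum_mem fun a _ => arrow_smul_mem a _

lemma mem_jacobson_iff (p : hull k V Y) :
    p ∈ Module.jacobson (RadSq k V) (hull k V Y) ↔ p.1.1 = 0 := by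
  let _ := Fintype.ofFinite (Arrow V)
  refine ⟨fun h => ?_, fun h => ?_⟩
  · obtain ⟨y, hy⟩ := exists_coord (k := k) h
    rw [hy.2, finsum_eq_sum_of_fintype, coe_sum]
    exact Finset.sum_eq_zero fun a _ => arrow_smul_fst a _
  · rw [eq_incl_add p, h, map_zero, zero_add]
    exact sum_arrow_smul_mem _

variable (k V Y) in
/-- The reduced differential projective module attached to a representation. -/
def reduced : Reduced.{max u v w, t} (RadSq k V) where
  obj :=
    { carrier := hull k V Y
      d := differential k V Y
      d_d := fun p => ext_vertex (fun i => by simp) fun a => by simp }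
  property := isReducedObj_of_d_mem fun p => (mem_jacobson_iff _).2 (differential_fst p)

lemma isCoord_differential (y : Y) :
    IsCoord (k := k) (differential k V Y (incl y)) fun a : Arrow V => incl (opArrow k a • y) := by
  let _ := Fintype.ofFinite (Arrow V)
  refine ⟨fun a => by rw [vertex_smul_incl, smul_smul, opVertex_mul_opArrow], ?_⟩
  conv_lhs => rw [eq_incl_add (differential k V Y (incl y))]
  simp [finsum_eq_sum_of_fintype]

variable (k V Y) in
/-- The projection to the top, with domain `hull k V Y`. -/
def topMk : hull k V Y →ₗ[RadSq k V] ModTop (reduced k V Y) := ModTop.mk (reduced k V Y)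

lemma topMk_eq_zero (p : hull k V Y) : topMk k V Y p = 0 ↔ p.1.1 = 0 :=
  ModTop.mk_eq_zero.trans (mem_jacobson_iff p)

variable (k V Y) in
/-- The map from a representation to the top of the attached differential module. -/
def toTop : Y →+ ModTop (reduced k V Y) :=
  (topMk k V Y).toAddMonoidHom.comp (incl (k := k) (V := V)).toAddMonoidHom

lemma toTop_apply (y : Y) : toTop k V Y y = topMk k V Y (incl y) := rfl

lemma toTop_smul (r : PathAlgebra k Vᵒᵖ) (y : Y) : toTop k V Y (r • y) = r • toTop k V Y y := by
  refine map_pathAlgebra_smul _ (fun c y => ?_) (fun i y => ?_) (fun i j f y => ?_) r y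
  · rw [_root_.algebraMap_smul, ModTop.algebraMap_smul, toTop_apply, toTop_apply,
      map_smul incl, ← map_smul (topMk k V Y), _root_.algebraMap_smul]
  · rw [← Opposite.op_unop i, ModTop.vertex_smul, toTop_apply, toTop_apply,
      ← map_smul (topMk k V Y), vertex_smul_incl]
  · rw [← Quiver.Hom.op_unop f, ModTop.arrow_smul, toTop_apply, toTop_apply]
    exact (ModTop.gamma_mk (M := reduced k V Y) (isCoord_differential y)
      (⟨j.unop, i.unop, f.unop⟩ : Arrow V)).symm

lemma toTop_bijective : Function.Bijective (toTop k V Y) := by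
  refine ⟨(injective_iff_map_eq_zero _).2 fun y hy => (topMk_eq_zero (incl y)).1 hy, fun t => ?_⟩
  obtain ⟨p, rfl⟩ : ∃ p, topMk k V Y p = t := ModTop.mk_surjective t
  refine ⟨p.1.1, ?_⟩
  rw [toTop_apply, ← sub_eq_zero, ← map_sub, topMk_eq_zero]
  exact sub_self p.1.1

end hull

/-- `F` is essentially surjective. -/
lemma exists_topFunctor_iso (Y : ModuleCat.{t} (PathAlgebra k Vᵒᵖ)) :
    ∃ M : Reduced.{max u v w, t} (RadSq k V), Nonempty ((topFunctor k V).obj M ≅ Y) := by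
  let _ : Module k Y := Module.compHom Y (algebraMap k (PathAlgebra k Vᵒᵖ))
  have : IsScalarTower k (PathAlgebra k Vᵒᵖ) Y := ⟨fun c r y => by
    rw [Algebra.smul_def, mul_smul]
    rfl⟩
  let φ : Y →ₗ[PathAlgebra k Vᵒᵖ] ModTop (hull.reduced k V Y) :=
    { toFun := hull.toTop k V Y, map_add' := map_add _, map_smul' := hull.toTop_smul }
  exact ⟨hull.reduced k V Y, ⟨(LinearEquiv.ofBijective φ hull.toTop_bijective).toModuleIso.symm⟩⟩

end Hull

/-! ### The correspondence of isomorphism classes -/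

section Correspondence

variable {k : Type u} [Field k] {V : Type v} [Quiver.{w} V] [Finite V]
  [∀ i j : V, Finite (i ⟶ j)]

lemma exists_reduced_iso (X : HomotopyCat.{max u v w, t} (RadSq k V)) :
    ∃ M : Reduced.{max u v w, t} (RadSq k V),
      Nonempty (X ≅ (toHomotopy (RadSq k V)).obj M.obj) :=
  exists_reduced X.as

variable (k V) in
/-- The relation between the objects of the homotopy category and the `kQ^op`-modules: `X` is
homotopy equivalent to a reduced object `M` with `F M ≅ Y`. -/
def Corresponds (X : HomotopyCat.{max u v w, t} (RadSq k V))
    (Y : ModuleCat.{t} (PathAlgebra k Vᵒᵖ)) : Prop :=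
  ∃ M : Reduced.{max u v w, t} (RadSq k V),
    Nonempty (X ≅ (toHomotopy (RadSq k V)).obj M.obj) ∧ Nonempty ((topFunctor k V).obj M ≅ Y)

namespace Corresponds

variable {X X' : HomotopyCat.{max u v w, t} (RadSq k V)}
  {Y Y' : ModuleCat.{t} (PathAlgebra k Vᵒᵖ)}

lemma exists_right (X : HomotopyCat.{max u v w, t} (RadSq k V)) : ∃ Y, Corresponds k V X Y :=
  let ⟨M, hM⟩ := exists_reduced_iso X
  ⟨_, M, hM, ⟨Iso.refl _⟩⟩

lemma exists_left (Y : ModuleCat.{t} (PathAlgebra k Vᵒᵖ)) : ∃ X, Corresponds k V X Y :=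
  let ⟨M, hM⟩ := exists_topFunctor_iso (k := k) (V := V) Y
  ⟨_, M, ⟨Iso.refl _⟩, hM⟩

lemma iso_left (h : Corresponds k V X Y) (e : X' ≅ X) : Corresponds k V X' Y :=
  let ⟨M, ⟨e'⟩, hY⟩ := h
  ⟨M, ⟨e ≪≫ e'⟩, hY⟩

lemma iso_right (h : Corresponds k V X Y) (e : Y ≅ Y') : Corresponds k V X Y' :=
  let ⟨M, hX, ⟨e'⟩⟩ := h
  ⟨M, hX, ⟨e' ≪≫ e⟩⟩

/-- `F` is defined up to isomorphism on the homotopy category. -/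
lemma unique_right (h : Corresponds k V X Y) (h' : Corresponds k V X Y') : Nonempty (Y ≅ Y') := by
  obtain ⟨M, ⟨e⟩, ⟨f⟩⟩ := h
  obtain ⟨M', ⟨e'⟩, ⟨f'⟩⟩ := h'
  obtain ⟨g⟩ := nonempty_topFunctor_iso (e.symm ≪≫ e')
  exact ⟨f.symm ≪≫ g ≪≫ f'⟩

/-- `F` reflects isomorphisms. -/
lemma unique_left (h : Corresponds k V X Y) (h' : Corresponds k V X' Y) : Nonempty (X ≅ X') := by
  obtain ⟨M, ⟨e⟩, ⟨f⟩⟩ := h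
  obtain ⟨M', ⟨e'⟩, ⟨f'⟩⟩ := h'
  obtain ⟨g⟩ := nonempty_iso_of_topFunctor_iso (f ≪≫ f'.symm)
  exact ⟨e ≪≫ (toHomotopy (RadSq k V)).mapIso g ≪≫ e'.symm⟩

lemma biprod (h : Corresponds k V X Y) (h' : Corresponds k V X' Y') :
    Corresponds k V (X ⊞ X') (Y ⊞ Y') := by
  obtain ⟨M, ⟨e⟩, ⟨f⟩⟩ := h
  obtain ⟨M', ⟨e'⟩, ⟨f'⟩⟩ := h'
  obtain ⟨g⟩ := nonempty_toHomotopy_sum_iso M M'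
  obtain ⟨g'⟩ := nonempty_topFunctor_sum_iso M M'
  exact ⟨reducedSum M M', ⟨biprod.mapIso e e' ≪≫ g.symm⟩, ⟨g' ≪≫ biprod.mapIso f f'⟩⟩

variable (k V) in
/-- The zero objects correspond to each other. -/
lemma exists_zero : ∃ (X : HomotopyCat.{max u v w, t} (RadSq k V))
    (Y : ModuleCat.{t} (PathAlgebra k Vᵒᵖ)), Corresponds k V X Y ∧ IsZero X ∧ IsZero Y := by
  let Z : DiffProj.{max u v w, t} (RadSq k V) :=
    { carrier := PUnit, d := 0, d_d := fun _ => rfl }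
  let M : Reduced.{max u v w, t} (RadSq k V) := ⟨Z, isReducedObj_of_d_mem fun _ => zero_mem _⟩
  refine ⟨(toHomotopy (RadSq k V)).obj Z, (topFunctor k V).obj M,
    ⟨M, ⟨Iso.refl _⟩, ⟨Iso.refl _⟩⟩, ?_, ?_⟩
  · rw [IsZero.iff_id_eq_zero, ← CategoryTheory.Functor.map_id,
      show 𝟙 Z = 0 from hom_ext fun _ => rfl, Functor.map_zero]
  · have : Subsingleton (ModTop M) := ⟨fun s t => by
      obtain ⟨x, rfl⟩ := ModTop.mk_surjective s
      obtain ⟨y, rfl⟩ := ModTop.mk_surjective t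
      rfl⟩
    exact ModuleCat.isZero_of_subsingleton (ModuleCat.of _ (ModTop M))

lemma isZero_iff (h : Corresponds k V X Y) : IsZero X ↔ IsZero Y := by
  obtain ⟨X₀, Y₀, h₀, hX₀, hY₀⟩ := exists_zero.{u, v, w, t} k V
  constructor
  · intro hX
    obtain ⟨e⟩ := (h₀.iso_left (hX.iso hX₀)).unique_right h
    exact hY₀.of_iso e.symm
  · intro hY
    obtain ⟨e⟩ := (h₀.iso_right (hY₀.iso hY)).unique_left h
    exact hX₀.of_iso e.symm

lemma indecomposable_iff (h : Corresponds k V X Y) : Indecomposable X ↔ Indecomposable Y := by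
  refine and_congr (not_congr h.isZero_iff) ⟨fun hX Y₁ Y₂ e => ?_, fun hY X₁ X₂ e => ?_⟩
  · obtain ⟨X₁, h₁⟩ := exists_left Y₁
    obtain ⟨X₂, h₂⟩ := exists_left Y₂
    obtain ⟨e'⟩ := (h.iso_right e).unique_left (h₁.biprod h₂)
    exact (hX X₁ X₂ e').imp h₁.isZero_iff.1 h₂.isZero_iff.1
  · obtain ⟨Y₁, h₁⟩ := exists_right X₁
    obtain ⟨Y₂, h₂⟩ := exists_right X₂
    obtain ⟨e'⟩ := (h.iso_left e.symm).unique_right (h₁.biprod h₂)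
    exact (hY Y₁ Y₂ e').imp h₁.isZero_iff.2 h₂.isZero_iff.2

end Corresponds

end Correspondence

end DifferentialProjective

end

open DifferentialProjective DifferentialProjective.DiffProj
theorem mainTheorem2 (k : Type u) [Field k] (V : Type v) [Quiver.{w} V] [Finite V]
    [∀ i j : V, Finite (i ⟶ j)] :
    (∀ X : HomotopyCat.{max u v w, t} (RadSq k V), ∃ M : Reduced.{max u v w, t} (RadSq k V),
      Nonempty (X ≅ (toHomotopy (RadSq k V)).obj M.obj)) ∧
    ∃ Φ : _root_.Quotient (isIsomorphicSetoid (HomotopyCat.{max u v w, t} (RadSq k V))) →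
        _root_.Quotient (isIsomorphicSetoid (ModuleCat.{t} (PathAlgebra k Vᵒᵖ))),
      (∀ M : Reduced.{max u v w, t} (RadSq k V),
        Φ ⟦(toHomotopy (RadSq k V)).obj M.obj⟧ = ⟦(topFunctor k V).obj M⟧) ∧
      Function.Bijective Φ ∧
      ∀ (X : HomotopyCat.{max u v w, t} (RadSq k V)) (Y : ModuleCat.{t} (PathAlgebra k Vᵒᵖ)),
        Φ ⟦X⟧ = ⟦Y⟧ → (Indecomposable X ↔ Indecomposable Y) := by
  refine ⟨exists_reduced_iso, ?_⟩
  choose G hG using Corresponds.exists_right.{u, v, w, t} (k := k) (V := V)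
  let Φ : _root_.Quotient (isIsomorphicSetoid (HomotopyCat.{max u v w, t} (RadSq k V))) →
      _root_.Quotient (isIsomorphicSetoid (ModuleCat.{t} (PathAlgebra k Vᵒᵖ))) :=
    _root_.Quotient.lift (fun X => ⟦G X⟧) fun X X' ⟨e⟩ =>
      _root_.Quotient.sound ((hG X).unique_right ((hG X').iso_left e))
  have hΦ : ∀ X Y, Φ ⟦X⟧ = ⟦Y⟧ ↔ Corresponds k V X Y := fun X Y =>
    ⟨fun h => let ⟨e⟩ := _root_.Quotient.exact h; (hG X).iso_right e,
      fun h => _root_.Quotient.sound ((hG X).unique_right h)⟩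
  refine ⟨Φ, fun M => (hΦ _ _).2 ⟨M, ⟨Iso.refl _⟩, ⟨Iso.refl _⟩⟩, ⟨?_, ?_⟩,
    fun X Y h => ((hΦ X Y).1 h).indecomposable_iff⟩
  · rintro ⟨X⟩ ⟨X'⟩ h
    exact _root_.Quotient.sound (((hΦ X (G X')).1 h).unique_left (hG X'))
  · rintro ⟨Y⟩
    obtain ⟨X, h⟩ := Corresponds.exists_left (V := V) Y
    exact ⟨⟦X⟧, (hΦ X Y).2 h⟩
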